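/- **Setting.** Let $n,N\ge 1$, let $\Omega\subset\mathbb R^n$ be a bounded domain and let $\mathrm{Hom}(\mathbb R^n;\mathbb R^N)\cong\mathbb R^{nN}$ carry the Euclidean norm. Let $L\ge 1$, $\mu\in(0,1]$, $\alpha\in(0,1]$, let $p:\Omega\to(1,\infty)$ be continuous with $1<\inf_\Omega p\le\sup_\Omega p<\infty$, and let $\omega:(0,\infty)\to(0,\infty)$ be continuous and non-decreasing with $\lim_{r\to0}\omega(r)=0$, $|p(x)-p(y)|\le\omega(|x-y|)$ for all $x\neq y$ in $\Omega$, and $\omega(r)\le Lr^\alpha$ for $0<r<1$. Let $f:\Omega\times\mathrm{Hom}(\mathbb R^n;\mathbb R^N)\to\mathbb R$ be such that, for all $x\in\Omega$ and $A\in\mathrm{Hom}(\mathbb R^n;\mathbb R^N)$: 1. (growth) $f(x,\cdot)\in C^2$ and $L^{-1}|A|^{p(x)}\le f(x,A)\le L(\mu^2+|A|^2)^{p(x)/2}$; 2. (strict quasi-convexity) for every ball $B_\rho(x)\Subset\Omega$ and $\varphi\in C_0^\infty(B_\rho(x);\mathbb R^N)$, $$\int_{B_\rho(x)}\big(f(x,A+D\varphi)-f(x,A)\big)\,dy\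 \ge\ \frac1L\int_{B_\rho(x)}(\mu^2+|A|^2+|D\varphi|^2)^{\frac{p(x)-2}{2}}|D\varphi|^2\,dy;$$ 3. (continuity) for all $y\in\Omega$, $y\ne x$, $$|f(x,A)-f(y,A)|\le L\,\omega(|x-y|)\big[(\mu^2+|A|^2)^{p(x)/2}+(\mu^2+|A|^2)^{p(y)/2}\big]\big[1+|\log(\mu^2+|A|^2)|\big].$$ A function $u\in W^{1,1}_{loc}(\Omega;\mathbb R^N)$ with $|Du|^{p(x)}\in L^1_{loc}(\Omega)$ is a local minimizer of $\mathcal F[w]=\int_\Omega f(x,Dw)\,dx$ if $\mathcal F[u]\le\mathcal F[u+\varphi]$ for all $\varphi\in W^{1,1}_0(\Omega;\mathbb R^N)$ with compact support in $\Omega$. For $B_{2\rho}(x_0)\Subset\Omega$ put $p_2=\sup_{B_{2\rho}(x_0)}p$, $V_{p_2}(\xi)=(1+|\xi|^2)^{(p_2-2)/4}\xi$, and $$\Phi=\Phi(x_0,\rho,A)=\Big(\frac1{|B_\rho(x_0)|}\int_{B_\rho(x_0)}|V_{p_2}(Du)-V_{p_2}(A)|^2\,dx\Big)^{1/2},$$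 where $|B_\rho(x_0)|$ denotes the volume of the ball. $|D^2f(x_0,\cdot)|$ denotes the norm as a bilinear form. **Lemma (approximate $\mathcal A$-harmonicity).** For each $\alpha\in(0,1]$ there is a radius $\rho_0=\rho_0(\alpha)>0$, and for all $n,N\ge1$, $1<q_1\le q_2$, $L\ge1$, $\bar M,\hat M>0$ and $K$ there is a constant $c_e=c_e(n,N,q_1,q_2,L,\bar M,\hat M,K)>0$ such that the following holds for all $\alpha,\mu,\Omega,p,\omega,f$ as above. Let $u$ be a local minimizer of $\mathcal F$ with $\int_\Omega|Du|^{p(x)}\,dx<\infty$, and let $0<\rho\le\rho_0(\alpha)$ and $B_{2\rho}(x_0)\Subset\Omega$ be such that $q_1\le p_2\le q_2$, $|Du|^{p_2}\in L^1(B_{2\rho}(x_0))$, $\frac1{|B_{2\rho}(x_0)|}\int_{B_{2\rho}(x_0)}|Du|^{p_2}\,dx\le\bar M$, and $|D^2f(x_0,B)|\le K$ for all $|B|\le\hat M+1$. Let $\nu=\nu_{\hat M,x_0}$ be a modulus of continuity of $D^2f(x_0,\cdot)$ on $\{|B|\le\hat M+1\}$, i.e. $\nu$ is non-decreasing on $[0,\infty)$,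 $\nu(t)\to0$ as $t\downarrow0$, and $|D^2f(x_0,B)-D^2f(x_0,B')|\le\nu(|B-B'|)$ for $|B|,|B'|\le\hat M+1$. Then for every $A\in\mathrm{Hom}(\mathbb R^n;\mathbb R^N)$ with $|A|\le\hat M$ and every $\varphi\in C^1_0(B_\rho(x_0);\mathbb R^N)$ ($C^1$ with compact support), $$\Big|\frac1{|B_\rho(x_0)|}\int_{B_\rho(x_0)}D^2f(x_0,A)(Du-A,D\varphi)\,dx\Big|\ \le\ c_e\Big(\Phi^2+\sqrt{\nu(\Phi)}\,\Phi+\sqrt{\omega(\rho)}\Big)\sup_{B_\rho(x_0)}|D\varphi| .$$ (Taking $q_1=q_2=p_2$, the constant depends on the exponent only through $p_2$.) -/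

import Mathlib

open MeasureTheory Set Filter Topology

noncomputable section

/-- `ℝⁿ` with the Euclidean norm. -/
abbrev Vec (n : ℕ) : Type := EuclideanSpace ℝ (Fin n)

/-- `Hom(ℝⁿ; ℝᴺ)`, identified with `ℝ^{N × n}` and carrying the Euclidean norm
`|A|² = ∑ A_{ij}²`; the entry `(i, j)` is the derivative of component `i` in direction `j`. -/
abbrev Hom (n N : ℕ) : Type := EuclideanSpace ℝ (Fin N × Fin n)

/-- The gradient `Dφ(x) ∈ Hom(ℝⁿ; ℝᴺ)` of a classically differentiable map `φ`. -/
def grad {n N : ℕ} (φ : Vec n → Vec N) (x : Vec n) : Hom n N :=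
  WithLp.toLp 2 fun ij => fderiv ℝ φ x (EuclideanSpace.single ij.2 1) ij.1

/-- `φ ∈ C^k₀(U; F)`: of class `C^k` with compact support contained in `U`. -/
def IsTestFun {n : ℕ} {F : Type*} [NormedAddCommGroup F] [NormedSpace ℝ F]
    (k : ℕ∞) (U : Set (Vec n)) (φ : Vec n → F) : Prop :=
  ContDiff ℝ k φ ∧ HasCompactSupport φ ∧ tsupport φ ⊆ U

/-- `G` is the weak gradient of `u` on `Ω`: `∫_Ω u_i ∂_jψ = - ∫_Ω G_{ij} ψ` for all
`ψ ∈ C_0^∞(Ω)`. -/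
def IsWeakGrad {n N : ℕ} (Ω : Set (Vec n)) (u : Vec n → Vec N) (G : Vec n → Hom n N) : Prop :=
  ∀ ψ : Vec n → ℝ, IsTestFun ⊤ Ω ψ → ∀ (i : Fin N) (j : Fin n),
    ∫ x in Ω, u x i * fderiv ℝ ψ x (EuclideanSpace.single j 1) = - ∫ x in Ω, G x (i, j) * ψ x

/-- `u ∈ W^{1,1}_loc(Ω; ℝᴺ)` with weak gradient `G`. -/
def IsSobolevLoc {n N : ℕ} (Ω : Set (Vec n)) (u : Vec n → Vec N) (G : Vec n → Hom n N) : Prop :=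
  LocallyIntegrableOn u Ω ∧ LocallyIntegrableOn G Ω ∧ IsWeakGrad Ω u G

/-- `φ ∈ W^{1,1}_0(Ω; ℝᴺ)` has compact support in `Ω`, and `H` is its weak gradient.
(A function of `W^{1,1}(Ω)` with compact support in `Ω` is in `W^{1,1}_0(Ω)` by mollification,
so the two classes of compactly supported functions are the same.) -/
def IsSobolevCompact {n N : ℕ} (Ω : Set (Vec n)) (φ : Vec n → Vec N) (H : Vec n → Hom n N) :
    Prop :=
  IntegrableOn φ Ω ∧ IntegrableOn H Ω ∧ IsWeakGrad Ω φ H ∧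
    ∃ k : Set (Vec n), IsCompact k ∧ k ⊆ Ω ∧ ∀ᵐ x ∂(volume.restrict Ω), x ∉ k → φ x = 0

/-- The energy `∫_Ω f(x, G(x)) dx ∈ [0, ∞]` of a non-negative integrand `f`. -/
def energy {n N : ℕ} (Ω : Set (Vec n)) (f : Vec n → Hom n N → ℝ) (G : Vec n → Hom n N) :
    ENNReal :=
  ∫⁻ x in Ω, ENNReal.ofReal (f x (G x))

/-- `u`, with weak gradient `Du`, is a local minimizer of `w ↦ ∫_Ω f(x, Dw) dx`. -/
structure IsLocalMinimizer {n N : ℕ} (Ω : Set (Vec n)) (f : Vec n → Hom n N → ℝ)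
    (p : Vec n → ℝ) (u : Vec n → Vec N) (Du : Vec n → Hom n N) : Prop where
  sobolev : IsSobolevLoc Ω u Du
  locallyIntegrable : LocallyIntegrableOn (fun x => ‖Du x‖ ^ p x) Ω
  minimal : ∀ (φ : Vec n → Vec N) (Dφ : Vec n → Hom n N), IsSobolevCompact Ω φ Dφ →
    energy Ω f Du ≤ energy Ω f (fun x => Du x + Dφ x)

/-- `ω : (0, ∞) → (0, ∞)` is a modulus of continuity of `p` on `Ω`
(the values of `ω` outside `(0, ∞)` play no role). -/
structure IsExponentModulus {n : ℕ} (Ω : Set (Vec n)) (p : Vec n → ℝ) (ω : ℝ → ℝ) : Prop where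
  pos : ∀ r, 0 < r → 0 < ω r
  mono : MonotoneOn ω (Ioi 0)
  cont : ContinuousOn ω (Ioi 0)
  tendsto : Tendsto ω (𝓝[>] 0) (𝓝 0)
  bound : ∀ x ∈ Ω, ∀ y ∈ Ω, x ≠ y → |p x - p y| ≤ ω (dist x y)

/-- The structure conditions on the integrand `f`, the exponent `p` and its modulus `ω`:
growth, strict quasi-convexity, and continuity in `x`, together with `ω(r) ≤ L r^α`. -/
structure StructureConditions {n N : ℕ} (Ω : Set (Vec n)) (f : Vec n → Hom n N → ℝ)
    (p : Vec n → ℝ) (ω : ℝ → ℝ) (μ L α : ℝ) : Prop where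
  mu_pos : 0 < μ
  mu_le : μ ≤ 1
  p_cont : ContinuousOn p Ω
  p_bounds : ∃ γ₁ γ₂ : ℝ, 1 < γ₁ ∧ ∀ x ∈ Ω, γ₁ ≤ p x ∧ p x ≤ γ₂
  smooth : ∀ x ∈ Ω, ContDiff ℝ 2 (f x)
  growth : ∀ x ∈ Ω, ∀ A : Hom n N,
    L⁻¹ * ‖A‖ ^ p x ≤ f x A ∧ f x A ≤ L * (μ ^ 2 + ‖A‖ ^ 2) ^ (p x / 2)
  quasiconvex : ∀ x₀ ∈ Ω, ∀ ρ : ℝ, 0 < ρ → Metric.closedBall x₀ ρ ⊆ Ω →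
    ∀ (A : Hom n N) (φ : Vec n → Vec N), IsTestFun ⊤ (Metric.ball x₀ ρ) φ →
      L⁻¹ * ∫ x in Metric.ball x₀ ρ,
          (μ ^ 2 + ‖A‖ ^ 2 + ‖grad φ x‖ ^ 2) ^ ((p x₀ - 2) / 2) * ‖grad φ x‖ ^ 2
        ≤ ∫ x in Metric.ball x₀ ρ, (f x₀ (A + grad φ x) - f x₀ A)
  omega_modulus : IsExponentModulus Ω p ω
  continuity : ∀ x ∈ Ω, ∀ y ∈ Ω, x ≠ y → ∀ A : Hom n N,
    |f x A - f y A| ≤ L * ω (dist x y) *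
      ((μ ^ 2 + ‖A‖ ^ 2) ^ (p x / 2) + (μ ^ 2 + ‖A‖ ^ 2) ^ (p y / 2)) *
      (1 + |Real.log (μ ^ 2 + ‖A‖ ^ 2)|)
  omega_holder : ∀ r : ℝ, 0 < r → r < 1 → ω r ≤ L * r ^ α

/-- The second derivative `D²g(A)` as a bilinear form on `Hom(ℝⁿ; ℝᴺ)`. -/
def D2 {n N : ℕ} (g : Hom n N → ℝ) (A : Hom n N) : Hom n N →L[ℝ] Hom n N →L[ℝ] ℝ :=
  fderiv ℝ (fderiv ℝ g) A

/-- `ν : [0, ∞) → [0, ∞)` is a modulus of continuity of `D²g` on `{|A| ≤ M + 1}`. -/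
structure IsD2Modulus {n N : ℕ} (g : Hom n N → ℝ) (M : ℝ) (ν : ℝ → ℝ) : Prop where
  mono : MonotoneOn ν (Ici 0)
  tendsto : Tendsto ν (𝓝[>] 0) (𝓝 0)
  bound : ∀ A B : Hom n N, ‖A‖ ≤ M + 1 → ‖B‖ ≤ M + 1 → ‖D2 g A - D2 g B‖ ≤ ν ‖A - B‖

/-- `p₂ = sup {p(x) : x ∈ B_{2ρ}(x₀)}`. -/
def pTwo {n : ℕ} (p : Vec n → ℝ) (x₀ : Vec n) (ρ : ℝ) : ℝ :=
  sSup (p '' Metric.ball x₀ (2 * ρ))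

/-- `V_q(ξ) = (1 + |ξ|²)^{(q-2)/4} ξ`. -/
def V {n N : ℕ} (q : ℝ) (ξ : Hom n N) : Hom n N :=
  ((1 + ‖ξ‖ ^ 2) ^ ((q - 2) / 4)) • ξ

/-- The excess `Φ(x₀, ρ, A) = (⨍_{B_ρ(x₀)} |V_{p₂}(Du) - V_{p₂}(A)|² dx)^{1/2}`. -/
def excess {n N : ℕ} (p : Vec n → ℝ) (Du : Vec n → Hom n N) (x₀ : Vec n) (ρ : ℝ)
    (A : Hom n N) : ℝ :=
  Real.sqrt (⨍ x in Metric.ball x₀ ρ,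
    ‖V (pTwo p x₀ ρ) (Du x) - V (pTwo p x₀ ρ) A‖ ^ 2)

end

/-! Normalise `φ` so that `|Dφ| ≤ 1` and compare `u` with `u + tφ` for `t = √ω(ρ)`. Minimality gives
`0 ≤ ∫ (f(x, Du + tDφ) - f(x, Du))`, and the integrand is bounded pointwise according to the
distance of `Du` from `A`.

Where `|Du - A| ≤ 1/2`, all arguments stay in the ball of radius `Mhat + 1`. There `f(x, ·)` may be
replaced by `f(x₀, ·)` at cost `Cω(ρ) = Ct²`, and Taylor's formula produces `t (Df(x₀,A) Dφ +
D²f(x₀,A)(Du - A, Dφ))` plus `Kt²` plus an error governed by `ν`. Elsewhere the coefficients are not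
frozen: the growth `|Df(x,B)| ≤ C(1 + |B|)^(p₂-1)` bounds the increment by `Ct(1 + |Du|)^p₂`, and
this is at most `Ct|V(Du) - V(A)|²`. The term with `Df(x₀,A)` integrates to zero, and division by
`t|B_ρ|` leaves `√ω(ρ)`, `√ν(Φ) Φ` and `Φ²`. Replacing `φ` by `-φ` gives the other inequality.

The two regimes rest on `norm_sub_sq_le_V_sub_sq` and `one_add_norm_rpow_le_V_sub_sq`. The growth of
`Df` follows from quasi-convexity through convexity in each matrix entry (`D2_single_nonneg`,
`norm_fderiv_le_of_growth`). Since `ν` need not be concave, Jensen's inequality is replaced by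
subdivision of segments (`IsD2Modulus.norm_sub_le_mul`). The pointwise bound is
`le_add_linearization`; the cases `Φ = 0` and `√ω(ρ) ≥ 1/2` are treated directly in
`abs_setAverage_D2_le`. -/

/-! ### Coercivity of `V`. -/

section Monotonicity

variable {E : Type*} [NormedAddCommGroup E] [InnerProductSpace ℝ E]

/-- Lower bound for a difference of rescaled vectors when the longer vector has the larger
factor. -/
theorem half_mul_norm_sub_le_of_factor_le {ξ η : E} {a b : ℝ} (hb : 0 ≤ b) (hab : b ≤ a)
    (h : ‖η‖ ≤ ‖ξ‖) : a / 2 * ‖ξ - η‖ ≤ ‖a • ξ - b • η‖ := by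
  -- The inner product equals `(a + b)/2 · |ξ - η|² + (a - b)/2 · (|ξ|² - |η|²)`.
  have key : a / 2 * ‖ξ - η‖ ^ 2 ≤ inner ℝ (a • ξ - b • η) (ξ - η) := by
    rw [norm_sub_sq_real]
    simp only [inner_sub_left, inner_sub_right, inner_smul_left, real_inner_self_eq_norm_sq,
      real_inner_comm ξ η, RCLike.conj_to_real]
    have h1 : 0 ≤ b * ‖ξ - η‖ ^ 2 := by positivity
    rw [norm_sub_sq_real] at h1
    have h2 : 0 ≤ (a - b) * (‖ξ‖ ^ 2 - ‖η‖ ^ 2) :=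
      mul_nonneg (by linarith) (by nlinarith [norm_nonneg η])
    have h3 : inner ℝ η ξ = inner ℝ ξ η := real_inner_comm ξ η
    simp only [h3] at *
    nlinarith
  have cs := real_inner_le_norm (a • ξ - b • η) (ξ - η)
  rcases (norm_nonneg (ξ - η)).eq_or_lt with h0 | h0
  · rw [← h0]; simp
  · have : a / 2 * ‖ξ - η‖ * ‖ξ - η‖ ≤ ‖a • ξ - b • η‖ * ‖ξ - η‖ := by nlinarith
    exact le_of_mul_le_mul_right this h0

/-- Lower bound for a difference of rescaled vectors when the shorter vector has the larger
factor. -/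
theorem half_mul_norm_sub_le_of_le_factor {ξ η : E} {a b : ℝ} (ha : 0 ≤ a) (hab : a ≤ b)
    (hn : ‖η‖ ≤ ‖ξ‖) (h : b * ‖η‖ ≤ a * ((‖ξ‖ + ‖η‖) / 2)) :
    a / 2 * ‖ξ - η‖ ≤ ‖a • ξ - b • η‖ := by
  refine le_of_sq_le_sq ?_ (norm_nonneg _)
  rw [mul_pow, norm_sub_sq_real, norm_sub_sq_real, norm_smul, norm_smul, inner_smul_left,
    inner_smul_right, Real.norm_of_nonneg ha, Real.norm_of_nonneg (ha.trans hab)]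
  simp only [RCLike.conj_to_real]
  have h1 : inner ℝ ξ η ≤ ‖ξ‖ * ‖η‖ := real_inner_le_norm _ _
  -- Both squared norms split into a radial part and a multiple of `|ξ||η| - ⟨ξ, η⟩`; `h2` compares
  -- the radial parts, `h3` the angular ones.
  have h2 : (a / 2 * (‖ξ‖ - ‖η‖)) ^ 2 ≤ (a * ‖ξ‖ - b * ‖η‖) ^ 2 := by
    apply pow_le_pow_left₀
    · have := sub_nonneg.2 hn
      positivity
    · nlinarith
  have h3 : (a / 2) ^ 2 * (2 * (‖ξ‖ * ‖η‖ - inner ℝ ξ η)) ≤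
      (a * b) * (2 * (‖ξ‖ * ‖η‖ - inner ℝ ξ η)) := by
    apply mul_le_mul_of_nonneg_right _ (by linarith)
    nlinarith
  nlinarith

end Monotonicity

/-- For exponents at least `-1/4` the function `r ↦ (1 + r²)^β r` grows at least half as fast as
`(1 + r²)^β r` with frozen factor. -/
theorem one_add_sq_rpow_mul_le {β r s : ℝ} (hβ : -(1 / 4) ≤ β) (hs : 0 ≤ s)
    (hsr : s ≤ r) : (1 + s ^ 2) ^ β * s ≤ (1 + r ^ 2) ^ β * ((r + s) / 2) := by
  rcases hs.eq_or_lt with rfl | hs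
  · have : 0 ≤ (1 + r ^ 2) ^ β * ((r + 0) / 2) := by positivity
    simpa using this
  have hr : 0 < r := hs.trans_le hsr
  have hX : 0 < 1 + r ^ 2 := by positivity
  have hY : 0 < 1 + s ^ 2 := by positivity
  -- For `s ≤ r` the quotient lies between `1` and `(r/s)²`, and `-β ≤ 1/4`; the remaining `√(r/s) ·
  -- s = √(rs)` is bounded by the arithmetic mean.
  have h1 : ((1 + r ^ 2) / (1 + s ^ 2)) ^ (-β) ≤ (r / s) ^ (1 / 2 : ℝ) := by
    have e1 : ((r / s) ^ 2) ^ (1 / 4 : ℝ) = (r / s) ^ (1 / 2 : ℝ) := by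
      rw [← Real.rpow_natCast (r / s) 2, ← Real.rpow_mul (by positivity)]
      norm_num
    rw [← e1]
    have hz1 : 1 ≤ (1 + r ^ 2) / (1 + s ^ 2) := by
      rw [one_le_div hY]
      nlinarith
    calc ((1 + r ^ 2) / (1 + s ^ 2)) ^ (-β) ≤ ((1 + r ^ 2) / (1 + s ^ 2)) ^ (1 / 4 : ℝ) :=
          Real.rpow_le_rpow_of_exponent_le hz1 (by linarith)
      _ ≤ _ := by
          apply Real.rpow_le_rpow (by positivity) _ (by norm_num)
          rw [div_pow, div_le_div_iff₀ hY (by positivity)]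
          nlinarith
  have h2 : (r / s) ^ (1 / 2 : ℝ) * s ≤ (r + s) / 2 := by
    rw [← Real.sqrt_eq_rpow]
    have h4 : (Real.sqrt (r / s)) ^ 2 = r / s := Real.sq_sqrt (by positivity)
    have h5 : r / s * s = r := by field_simp
    nlinarith [sq_nonneg (Real.sqrt (r / s) - 1)]
  have h3 : ((1 + r ^ 2) / (1 + s ^ 2)) ^ (-β) * (1 + r ^ 2) ^ β = (1 + s ^ 2) ^ β := by
    rw [Real.div_rpow hX.le hY.le, Real.rpow_neg hX.le, Real.rpow_neg hY.le]
    have := (Real.rpow_pos_of_pos hX β).ne'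
    have := (Real.rpow_pos_of_pos hY β).ne'
    field_simp
  rw [← h3]
  calc _ = (1 + r ^ 2) ^ β * (((1 + r ^ 2) / (1 + s ^ 2)) ^ (-β) * s) := by ring
    _ ≤ _ := by
      apply mul_le_mul_of_nonneg_left _ (by positivity)
      exact (mul_le_mul_of_nonneg_right h1 hs.le).trans h2

/-- The scalar factor of `V` increases with the norm for `q ≥ 2` and decreases for `q ≤ 2`, one case
for each of the two vector inequalities above; `q ≥ 1` makes the exponent at least `-1/4`. -/
theorem V_sub_lower_of_norm_le {n N : ℕ} {q : ℝ} (hq : 1 ≤ q) {ξ η : Hom n N} (h : ‖η‖ ≤ ‖ξ‖) :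
    (1 + ‖ξ‖ ^ 2) ^ ((q - 2) / 4) / 2 * ‖ξ - η‖ ≤ ‖V q ξ - V q η‖ := by
  unfold V
  have hsq : 1 + ‖η‖ ^ 2 ≤ 1 + ‖ξ‖ ^ 2 := by nlinarith [norm_nonneg η]
  rcases le_total 2 q with h2 | h2
  · apply half_mul_norm_sub_le_of_factor_le (by positivity) _ h
    exact Real.rpow_le_rpow (by positivity) hsq (by linarith)
  · apply half_mul_norm_sub_le_of_le_factor (by positivity) _ h
    · exact one_add_sq_rpow_mul_le (by linarith) (norm_nonneg _) h
    · exact Real.rpow_le_rpow_of_nonpos (by positivity) hsq (by linarith)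

/-- Here `m` is the larger norm. The weight is kept at `m` because its monotonicity in `m` depends
on the sign of `q - 2`. -/
theorem V_sub_sq_lower {n N : ℕ} {q : ℝ} (hq : 1 ≤ q) (ξ η : Hom n N) :
    ∃ m : ℝ, (m = ‖ξ‖ ∨ m = ‖η‖) ∧ ‖ξ‖ ≤ m ∧ ‖η‖ ≤ m ∧
      (1 + m ^ 2) ^ ((q - 2) / 2) * ‖ξ - η‖ ^ 2 ≤ 4 * ‖V q ξ - V q η‖ ^ 2 := by
  have sq : ∀ m : ℝ, ((1 + m ^ 2) ^ ((q - 2) / 4)) ^ 2 = (1 + m ^ 2) ^ ((q - 2) / 2) := by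
    intro m
    rw [← Real.rpow_natCast, ← Real.rpow_mul (by positivity)]
    congr 1
    push_cast
    ring
  rcases le_total ‖η‖ ‖ξ‖ with h | h
  · refine ⟨‖ξ‖, Or.inl rfl, le_rfl, h, ?_⟩
    have := pow_le_pow_left₀ (by positivity) (V_sub_lower_of_norm_le hq h) 2
    rw [← sq]
    nlinarith
  · refine ⟨‖η‖, Or.inr rfl, h, le_rfl, ?_⟩
    have := pow_le_pow_left₀ (by positivity) (V_sub_lower_of_norm_le hq h) 2
    rw [← sq, norm_sub_rev ξ, norm_sub_rev (V q ξ)]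
    nlinarith

/-- Near `A` one has `m ≤ M + 1`, so the weight is at least `(1 + m²)^(-1/2) ≥ 1/(2 + M)`, uniformly
in `q`. -/
theorem norm_sub_sq_le_V_sub_sq {n N : ℕ} {q M : ℝ} (hq : 1 ≤ q) {ξ A : Hom n N}
    (hA : ‖A‖ ≤ M) (h : ‖ξ - A‖ ≤ 1 / 2) :
    ‖ξ - A‖ ^ 2 ≤ 4 * (2 + M) * ‖V q ξ - V q A‖ ^ 2 := by
  have hM : 0 ≤ M := (norm_nonneg A).trans hA
  obtain ⟨m, hmm, hm1, hm2, hm⟩ := V_sub_sq_lower hq ξ A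
  have hmle : m ≤ M + 1 := by
    rcases hmm with rfl | rfl
    · have := norm_sub_norm_le ξ A
      linarith
    · linarith
  have hm0 : 0 ≤ m := (norm_nonneg _).trans hm1
  have hlow : 1 ≤ (2 + M) * (1 + m ^ 2) ^ ((q - 2) / 2) := by
    have h1 : (1 + m ^ 2) ^ (-(1 / 2) : ℝ) ≤ (1 + m ^ 2) ^ ((q - 2) / 2) :=
      Real.rpow_le_rpow_of_exponent_le (by nlinarith) (by linarith)
    rw [Real.rpow_neg (by positivity), ← Real.sqrt_eq_rpow] at h1
    have h2 : Real.sqrt (1 + m ^ 2) ≤ 2 + M := by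
      apply Real.sqrt_le_iff.2 ⟨by linarith, by nlinarith⟩
    have h3 : (2 + M)⁻¹ ≤ (Real.sqrt (1 + m ^ 2))⁻¹ := by
      apply inv_anti₀ _ h2
      positivity
    have h4 : (2 + M) * (2 + M)⁻¹ = 1 := mul_inv_cancel₀ (by linarith)
    exact h4.ge.trans (mul_le_mul_of_nonneg_left (h3.trans h1) (by linarith))
  calc ‖ξ - A‖ ^ 2 ≤ ((2 + M) * (1 + m ^ 2) ^ ((q - 2) / 2)) * ‖ξ - A‖ ^ 2 :=
        le_mul_of_one_le_left (by positivity) hlow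
    _ = (2 + M) * ((1 + m ^ 2) ^ ((q - 2) / 2) * ‖ξ - A‖ ^ 2) := by ring
    _ ≤ (2 + M) * (4 * ‖V q ξ - V q A‖ ^ 2) := mul_le_mul_of_nonneg_left hm (by linarith)
    _ = _ := by ring

/-- Away from `A`, `1 + |ξ|` is comparable to `|ξ - A|`; writing the power as `Z^(q-2) Z²` reduces
the claim to comparing `Z^(q-2)` with the weight at `m`. -/
theorem one_add_norm_rpow_le_V_sub_sq {n N : ℕ} {q Q M : ℝ} (hq : 1 ≤ q) (hqQ : q ≤ Q)
    {ξ A : Hom n N} (hA : ‖A‖ ≤ M) (h : 1 / 2 ≤ ‖ξ - A‖) :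
    (1 + ‖ξ‖) ^ q ≤ 4 * ((1 + M) * 2 ^ Q) * (3 + 2 * M) ^ 2 * ‖V q ξ - V q A‖ ^ 2 := by
  have hM : 0 ≤ M := (norm_nonneg A).trans hA
  obtain ⟨m, hmm, hm1, hm2, hm⟩ := V_sub_sq_lower hq ξ A
  have hm0 : 0 ≤ m := (norm_nonneg _).trans hm1
  set Z := 1 + ‖ξ‖ with hZ
  have hZ1 : 1 ≤ Z := by linarith [norm_nonneg ξ]
  have hZ0 : 0 < Z := by linarith
  have h2Q : (1 : ℝ) ≤ 2 ^ Q := Real.one_le_rpow (by norm_num) (by linarith)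
  have ha : Z ≤ (3 + 2 * M) * ‖ξ - A‖ := by
    have := norm_sub_norm_le ξ A
    nlinarith
  have hlow : Z ^ (q - 2) ≤ ((1 + M) * 2 ^ Q) * (1 + m ^ 2) ^ ((q - 2) / 2) := by
    rcases le_total 2 q with h2 | h2
    · have e : Z ^ (q - 2) = (Z ^ 2) ^ ((q - 2) / 2) := by
        rw [← Real.rpow_natCast, ← Real.rpow_mul hZ0.le]
        congr 1
        push_cast
        ring
      have h3 : Z ^ 2 ≤ 2 * (1 + m ^ 2) := by
        have : ‖ξ‖ ^ 2 ≤ m ^ 2 := pow_le_pow_left₀ (norm_nonneg _) hm1 2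
        nlinarith [sq_nonneg (1 - ‖ξ‖)]
      calc Z ^ (q - 2) = (Z ^ 2) ^ ((q - 2) / 2) := e
        _ ≤ (2 * (1 + m ^ 2)) ^ ((q - 2) / 2) :=
          Real.rpow_le_rpow (by positivity) h3 (by linarith)
        _ = 2 ^ ((q - 2) / 2) * (1 + m ^ 2) ^ ((q - 2) / 2) :=
          Real.mul_rpow (by norm_num) (by positivity)
        _ ≤ ((1 + M) * 2 ^ Q) * (1 + m ^ 2) ^ ((q - 2) / 2) := by
          apply mul_le_mul_of_nonneg_right _ (by positivity)
          have : (2 : ℝ) ^ ((q - 2) / 2) ≤ 2 ^ Q :=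
            Real.rpow_le_rpow_of_exponent_le (by norm_num) (by linarith)
          nlinarith
    · have e : ((1 + M) * Z) ^ (q - 2) = (((1 + M) * Z) ^ 2) ^ ((q - 2) / 2) := by
        rw [← Real.rpow_natCast, ← Real.rpow_mul (by positivity)]
        congr 1
        push_cast
        ring
      have hmZ : 1 + m ≤ (1 + M) * Z := by
        rcases hmm with rfl | rfl
        · nlinarith
        · nlinarith
      have h3 : 1 + m ^ 2 ≤ ((1 + M) * Z) ^ 2 := by
        have := pow_le_pow_left₀ (by positivity) hmZ 2
        nlinarith
      have h4 : (1 + M) ^ (-1 : ℝ) ≤ (1 + M) ^ (q - 2) :=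
        Real.rpow_le_rpow_of_exponent_le (by linarith) (by linarith)
      have h5 : ((1 + M) * Z) ^ (q - 2) ≤ (1 + m ^ 2) ^ ((q - 2) / 2) := by
        rw [e]
        exact Real.rpow_le_rpow_of_nonpos (by positivity) h3 (by linarith)
      rw [Real.mul_rpow (by positivity) hZ0.le] at h5
      rw [Real.rpow_neg_one] at h4
      have hW : 0 < Z ^ (q - 2) := Real.rpow_pos_of_pos hZ0 _
      have h6 : (1 + M)⁻¹ * Z ^ (q - 2) ≤ (1 + m ^ 2) ^ ((q - 2) / 2) :=
        (mul_le_mul_of_nonneg_right h4 hW.le).trans h5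
      calc Z ^ (q - 2) = (1 + M) * ((1 + M)⁻¹ * Z ^ (q - 2)) := by
            field_simp
        _ ≤ (1 + M) * (1 + m ^ 2) ^ ((q - 2) / 2) :=
            mul_le_mul_of_nonneg_left h6 (by linarith)
        _ ≤ _ := by
            apply mul_le_mul_of_nonneg_right _ (by positivity)
            nlinarith
  calc Z ^ q = Z ^ (q - 2) * Z ^ 2 := by
        rw [← Real.rpow_natCast Z 2, ← Real.rpow_add hZ0]
        norm_num
    _ ≤ (((1 + M) * 2 ^ Q) * (1 + m ^ 2) ^ ((q - 2) / 2)) * ((3 + 2 * M) * ‖ξ - A‖) ^ 2 :=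
        mul_le_mul hlow (pow_le_pow_left₀ hZ0.le ha 2) (by positivity) (by positivity)
    _ = ((1 + M) * 2 ^ Q) * (3 + 2 * M) ^ 2 *
          ((1 + m ^ 2) ^ ((q - 2) / 2) * ‖ξ - A‖ ^ 2) := by ring
    _ ≤ ((1 + M) * 2 ^ Q) * (3 + 2 * M) ^ 2 * (4 * ‖V q ξ - V q A‖ ^ 2) :=
        mul_le_mul_of_nonneg_left hm (by positivity)
    _ = _ := by ring

theorem one_add_sq_rpow_half_le {q s : ℝ} (hq : 0 ≤ q) (hs : 0 ≤ s) :
    (1 + s ^ 2) ^ (q / 2) ≤ 2 ^ q * (1 + s ^ q) := by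
  have h2 : (1 + s ^ 2) ^ (q / 2) ≤ (2 * max 1 s) ^ q := by
    have e : (2 * max 1 s) ^ q = ((2 * max 1 s) ^ 2) ^ (q / 2) := by
      rw [← Real.rpow_natCast, ← Real.rpow_mul (by positivity)]
      congr 1
      push_cast
      ring
    rw [e]
    apply Real.rpow_le_rpow (by positivity) _ (by positivity)
    have := le_max_left 1 s
    have := le_max_right 1 s
    nlinarith
  refine h2.trans ?_
  rw [Real.mul_rpow (by norm_num) (by positivity)]
  apply mul_le_mul_of_nonneg_left _ (by positivity)
  have hn : 0 ≤ s ^ q := by positivity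
  rcases le_total 1 s with h | h
  · rw [max_eq_right h]; linarith
  · rw [max_eq_left h]; simpa using hn

theorem norm_V_sq_le {n N : ℕ} {q : ℝ} (hq : 0 ≤ q) (ξ : Hom n N) :
    ‖V q ξ‖ ^ 2 ≤ 2 ^ q * (1 + ‖ξ‖ ^ q) := by
  have h0 : 0 < 1 + ‖ξ‖ ^ 2 := by positivity
  refine le_trans ?_ (one_add_sq_rpow_half_le hq (norm_nonneg ξ))
  unfold V
  rw [norm_smul, mul_pow, Real.norm_of_nonneg (by positivity), ← Real.rpow_natCast,
    ← Real.rpow_mul h0.le]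
  have e : (1 + ‖ξ‖ ^ 2) ^ (q / 2) =
      (1 + ‖ξ‖ ^ 2) ^ ((q - 2) / 4 * (2 : ℕ)) * (1 + ‖ξ‖ ^ 2) := by
    rw [← Real.rpow_add_one h0.ne']
    congr 1
    push_cast
    ring
  rw [e]
  apply mul_le_mul_of_nonneg_left _ (by positivity)
  linarith

theorem continuous_V {n N : ℕ} (q : ℝ) : Continuous (V (n := n) (N := N) q) := by
  unfold V
  have h : Continuous fun ξ : Hom n N => (1 + ‖ξ‖ ^ 2) ^ ((q - 2) / 4) :=
    Continuous.rpow_const (by fun_prop) fun x => Or.inl (by positivity)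
  fun_prop

/-! ### Gradients of test functions and integration by parts. -/

section Gradient

variable {n N : ℕ}

/-- The matrix of a linear map. -/
noncomputable def matrixOf : (Vec n →L[ℝ] Vec N) →ₗ[ℝ] Hom n N where
  toFun T := WithLp.toLp 2 fun ij => T (EuclideanSpace.single ij.2 1) ij.1
  map_add' S T := by ext ij; simp
  map_smul' c T := by ext ij; simp

theorem grad_eq_matrixOf (φ : Vec n → Vec N) (x : Vec n) : grad φ x = matrixOf (fderiv ℝ φ x) :=
  rfl

theorem grad_apply (φ : Vec n → Vec N) (x : Vec n) (i : Fin N) (j : Fin n) :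
    grad φ x (i, j) = fderiv ℝ φ x (EuclideanSpace.single j 1) i := rfl

theorem continuous_grad {φ : Vec n → Vec N} (hφ : ContDiff ℝ 1 φ) : Continuous (grad φ) :=
  matrixOf.continuous_of_finiteDimensional.comp (hφ.continuous_fderiv one_ne_zero)

theorem grad_const_smul (φ : Vec n → Vec N) (c : ℝ) (x : Vec n) :
    grad (fun y => c • φ y) x = c • grad φ x := by
  rw [grad_eq_matrixOf, grad_eq_matrixOf, ← map_smul]
  congr 1
  exact congrFun (fderiv_const_smul_field (f := φ) c) x

theorem grad_eq_zero_of_notMem {φ : Vec n → Vec N} {x : Vec n} (hx : x ∉ tsupport φ) :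
    grad φ x = 0 := by
  have : fderiv ℝ φ x = 0 := by
    by_contra h
    exact hx (support_fderiv_subset ℝ (f := φ) h)
  rw [grad_eq_matrixOf, this, map_zero]

theorem HasCompactSupport.grad {φ : Vec n → Vec N} (h : HasCompactSupport φ) :
    HasCompactSupport (grad φ) :=
  HasCompactSupport.intro h fun _ hx => grad_eq_zero_of_notMem hx

theorem integrable_grad {φ : Vec n → Vec N} (hφ : ContDiff ℝ 1 φ) (hc : HasCompactSupport φ) :
    Integrable (grad φ) :=
  (continuous_grad hφ).integrable_of_hasCompactSupport hc.grad

theorem exists_norm_grad_le {φ : Vec n → Vec N} (hφ : ContDiff ℝ 1 φ)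
    (hc : HasCompactSupport φ) : ∃ R, ∀ x, ‖grad φ x‖ ≤ R :=
  hc.grad.exists_bound_of_continuous (continuous_grad hφ)

theorem fderiv_coord {φ : Vec n → Vec N} {x : Vec n} (hφ : DifferentiableAt ℝ φ x) (i : Fin N) :
    fderiv ℝ (fun y => φ y i) x =
      (EuclideanSpace.proj i : Vec N →L[ℝ] ℝ).comp (fderiv ℝ φ x) :=
  ((EuclideanSpace.proj i : Vec N →L[ℝ] ℝ).hasFDerivAt.comp x hφ.hasFDerivAt).fderiv

theorem HasCompactSupport.coord {φ : Vec n → Vec N} (h : HasCompactSupport φ) (i : Fin N) :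
    HasCompactSupport fun y => φ y i :=
  h.comp_left (g := fun v : Vec N => v i) rfl

theorem ContDiff.coord {k : WithTop ℕ∞} {φ : Vec n → Vec N} (h : ContDiff ℝ k φ) (i : Fin N) :
    ContDiff ℝ k fun y => φ y i :=
  (EuclideanSpace.proj i : Vec N →L[ℝ] ℝ).contDiff.comp h

theorem integral_fderiv_mul_eq_neg {φ : Vec n → Vec N} (hφ : ContDiff ℝ 1 φ)
    (hc : HasCompactSupport φ) {ψ : Vec n → ℝ} (hψ : ContDiff ℝ 1 ψ) (i : Fin N) (j : Fin n) :
    ∫ x, φ x i * fderiv ℝ ψ x (EuclideanSpace.single j 1) = -∫ x, grad φ x (i, j) * ψ x := by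
  have hg : ∀ x, grad φ x (i, j) = fderiv ℝ (fun y => φ y i) x (EuclideanSpace.single j 1) := by
    intro x
    rw [fderiv_coord (hφ.differentiable one_ne_zero x)]
    rfl
  simp only [hg]
  have hci := hc.coord i
  have hφi := hφ.coord i
  have c1 : Continuous fun x => fderiv ℝ (fun y => φ y i) x (EuclideanSpace.single j (1 : ℝ)) :=
    (hφi.continuous_fderiv one_ne_zero).clm_apply continuous_const
  have c2 : Continuous fun x => fderiv ℝ ψ x (EuclideanSpace.single j (1 : ℝ)) :=
    (hψ.continuous_fderiv one_ne_zero).clm_apply continuous_const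
  apply integral_mul_fderiv_eq_neg_fderiv_mul_of_integrable
  · exact (c1.mul hψ.continuous).integrable_of_hasCompactSupport
      ((hci.fderiv_apply ℝ _).mul_right)
  · exact (hφi.continuous.mul c2).integrable_of_hasCompactSupport hci.mul_right
  · exact (hφi.continuous.mul hψ.continuous).integrable_of_hasCompactSupport hci.mul_right
  · exact fun x _ => hφi.differentiable one_ne_zero x
  · exact fun x _ => hψ.differentiable one_ne_zero x

theorem integral_grad {φ : Vec n → Vec N} (hφ : ContDiff ℝ 1 φ) (hc : HasCompactSupport φ) :
    ∫ x, grad φ x = 0 := by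
  ext ⟨i, j⟩
  have h := integral_fderiv_mul_eq_neg hφ hc (ψ := fun _ => 1) contDiff_const i j
  have e := (EuclideanSpace.proj (i, j) : Hom n N →L[ℝ] ℝ).integral_comp_comm
    (integrable_grad hφ hc)
  simp only [fderiv_fun_const, Pi.zero_apply, zero_apply, mul_zero,
    integral_zero, mul_one] at h
  have e' : (∫ x, grad φ x) (i, j) = ∫ x, grad φ x (i, j) := e.symm
  rw [e']
  simpa using h

theorem integral_clm_grad (ℓ : Hom n N →L[ℝ] ℝ) {φ : Vec n → Vec N} (hφ : ContDiff ℝ 1 φ)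
    (hc : HasCompactSupport φ) {U : Set (Vec n)} (hU : tsupport φ ⊆ U) :
    ∫ x in U, ℓ (grad φ x) = 0 := by
  rw [setIntegral_eq_integral_of_forall_compl_eq_zero, ℓ.integral_comp_comm
    (integrable_grad hφ hc), integral_grad hφ hc, map_zero]
  intro x hx
  rw [grad_eq_zero_of_notMem fun h => hx (hU h), map_zero]

/-- A `C¹` function with compact support in `Ω` is an admissible variation. -/
theorem IsTestFun.isSobolevCompact {Ω : Set (Vec n)} {φ : Vec n → Vec N} (h : IsTestFun 1 Ω φ) :
    IsSobolevCompact Ω φ (grad φ) := by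
  obtain ⟨h1, h2, h3⟩ := h
  refine ⟨(h1.continuous.integrable_of_hasCompactSupport h2).integrableOn,
    (integrable_grad h1 h2).integrableOn, ?_, tsupport φ, h2, h3, ?_⟩
  · intro ψ hψ i j
    have := integral_fderiv_mul_eq_neg h1 h2 (hψ.1.of_le (by exact_mod_cast le_top)) i j
    rw [setIntegral_eq_integral_of_forall_compl_eq_zero,
      setIntegral_eq_integral_of_forall_compl_eq_zero]
    · exact this
    · intro x hx
      rw [grad_eq_zero_of_notMem fun h => hx (h3 h)]
      simp
    · intro x hx
      rw [image_eq_zero_of_notMem_tsupport fun h => hx (h3 h)]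
      simp
  · exact Eventually.of_forall fun x hx => image_eq_zero_of_notMem_tsupport hx

theorem IsTestFun.const_smul {k : ℕ∞} {U : Set (Vec n)} {φ : Vec n → Vec N}
    (h : IsTestFun k U φ) (c : ℝ) : IsTestFun k U fun x => c • φ x := by
  have hs : tsupport (fun x => c • φ x) ⊆ tsupport φ :=
    closure_mono (Function.support_const_smul_subset c φ)
  exact ⟨h.1.const_smul c, h.2.1.of_isClosed_subset (isClosed_tsupport _) hs, hs.trans h.2.2⟩

theorem grad_smul {c : Vec n → ℝ} {φ : Vec n → Vec N} {x : Vec n} (hc : DifferentiableAt ℝ c x)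
    (hφ : DifferentiableAt ℝ φ x) (i : Fin N) (j : Fin n) :
    grad (fun y => c y • φ y) x (i, j) =
      c x * grad φ x (i, j) + fderiv ℝ c x (EuclideanSpace.single j 1) * φ x i := by
  rw [grad_apply, fderiv_fun_smul hc hφ]
  simp [grad_apply]

end Gradient

theorem euclideanSpace_sum_single {ι : Type*} [Fintype ι] [DecidableEq ι]
    (ξ : EuclideanSpace ℝ ι) : ∑ i, ξ i • EuclideanSpace.single i (1 : ℝ) = ξ := by
  ext k
  simp [Pi.single_apply]

theorem clm_norm_le_sum {ι : Type*} [Fintype ι] [DecidableEq ι]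
    (ℓ : EuclideanSpace ℝ ι →L[ℝ] ℝ) : ‖ℓ‖ ≤ ∑ i, |ℓ (EuclideanSpace.single i 1)| := by
  apply ContinuousLinearMap.opNorm_le_bound _ (by positivity)
  intro ξ
  conv_lhs => rw [← euclideanSpace_sum_single ξ]
  rw [map_sum, Finset.sum_mul]
  refine (norm_sum_le _ _).trans (Finset.sum_le_sum fun i _ => ?_)
  rw [map_smul, smul_eq_mul, norm_mul, mul_comm]
  exact mul_le_mul_of_nonneg_left (PiLp.norm_apply_le ξ i) (abs_nonneg _)

theorem Continuous.integrableOn_ball {n : ℕ} {F : Type*} [NormedAddCommGroup F]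
    {h : Vec n → F} (hh : Continuous h) (x : Vec n) (r : ℝ) : IntegrableOn h (Metric.ball x r) :=
  (hh.continuousOn.integrableOn_compact (isCompact_closedBall x r)).mono_set
    Metric.ball_subset_closedBall

/-! ### From quasi-convexity to the growth of the first derivative. -/

section SecondOrder

variable {n N : ℕ} {g : Hom n N → ℝ}

theorem hasFDerivAt_fderiv (hg : ContDiff ℝ 2 g) (A : Hom n N) :
    HasFDerivAt (fderiv ℝ g) (D2 g A) A :=
  (((hg.fderiv_right (m := 1) (by norm_num)).differentiable one_ne_zero) A).hasFDerivAt

theorem hasDerivAt_line (hg : ContDiff ℝ 2 g) (A v : Hom n N) (s : ℝ) :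
    HasDerivAt (fun s : ℝ => g (A + s • v)) (fderiv ℝ g (A + s • v) v) s := by
  have h1 : HasDerivAt (fun s : ℝ => A + s • v) v s := by
    simpa using ((hasDerivAt_id s).smul_const v).const_add A
  exact ((hg.differentiable two_ne_zero) (A + s • v)).hasFDerivAt.comp_hasDerivAt s h1

theorem hasDerivAt_fderiv_line (hg : ContDiff ℝ 2 g) (A v w : Hom n N) (s : ℝ) :
    HasDerivAt (fun s : ℝ => fderiv ℝ g (A + s • v) w) (D2 g (A + s • v) v w) s := by
  have h1 : HasDerivAt (fun s : ℝ => A + s • v) v s := by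
    simpa using ((hasDerivAt_id s).smul_const v).const_add A
  have h2 := (hasFDerivAt_fderiv hg (A + s • v)).comp_hasDerivAt s h1
  simpa using h2.clm_apply (hasDerivAt_const s w)

/-- The mean value theorem is applied to the Taylor remainder along the segment, whose derivative is
small by differentiability of `Dg` at the single point `A`. -/
theorem exists_taylor_two_le (hg : ContDiff ℝ 2 g) (A : Hom n N) {δ : ℝ} (hδ : 0 < δ) :
    ∃ r > 0, ∀ v : Hom n N, ‖v‖ ≤ r →
      g (A + v) - g A ≤ fderiv ℝ g A v + 2⁻¹ * D2 g A v v + δ * ‖v‖ ^ 2 := by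
  have h := (hasFDerivAt_fderiv hg A).isLittleO.def hδ
  obtain ⟨r, hr, hball⟩ := Metric.eventually_nhds_iff.1 h
  refine ⟨r / 2, by positivity, fun v hv => ?_⟩
  obtain ⟨s, hs, hs'⟩ := exists_hasDerivAt_eq_slope
    (fun s : ℝ => g (A + s • v) - s * fderiv ℝ g A v - 2⁻¹ * s ^ 2 * D2 g A v v)
    (fun s : ℝ => fderiv ℝ g (A + s • v) v - fderiv ℝ g A v - s * D2 g A v v)
    (zero_lt_one) (by
      have : Continuous g := hg.continuous
      fun_prop) (by
      intro s _
      have h1 := hasDerivAt_line hg A v s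
      have h2 := (hasDerivAt_id s).mul_const (fderiv ℝ g A v)
      have h3 := (((hasDerivAt_id s).pow 2).const_mul (2⁻¹ : ℝ)).mul_const (D2 g A v v)
      refine ((h1.sub h2).sub h3).congr_deriv ?_
      simp)
  simp only [one_smul, zero_smul, add_zero, sub_zero, div_one] at hs'
  have hsv : ‖s • v‖ ≤ ‖v‖ := by
    rw [norm_smul, Real.norm_of_nonneg hs.1.le]
    exact mul_le_of_le_one_left (norm_nonneg _) hs.2.le
  have hb := hball (y := A + s • v) (by
    rw [dist_eq_norm, add_sub_cancel_left]
    linarith)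
  rw [add_sub_cancel_left] at hb
  have hb2 := (fderiv ℝ g (A + s • v) - fderiv ℝ g A - D2 g A (s • v)).le_opNorm v
  have hb3 : fderiv ℝ g (A + s • v) v - fderiv ℝ g A v - s * D2 g A v v ≤ δ * ‖v‖ ^ 2 := by
    have e : (fderiv ℝ g (A + s • v) - fderiv ℝ g A - D2 g A (s • v)) v =
      fderiv ℝ g (A + s • v) v - fderiv ℝ g A v - s * D2 g A v v := by simp
    rw [← e]
    refine (le_abs_self _).trans (hb2.trans ?_)
    calc _ ≤ (δ * ‖v‖) * ‖v‖ := by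
          apply mul_le_mul_of_nonneg_right _ (norm_nonneg _)
          exact hb.trans (mul_le_mul_of_nonneg_left hsv hδ.le)
      _ = _ := by ring
  linarith

/-- A quasi-convex integrand has a non-negative second variation. -/
theorem second_variation_nonneg (hg : ContDiff ℝ 2 g) {A : Hom n N} {x : Vec n} {r : ℝ}
    (hqc : ∀ φ : Vec n → Vec N, IsTestFun ⊤ (Metric.ball x r) φ →
      0 ≤ ∫ y in Metric.ball x r, (g (A + grad φ y) - g A))
    {φ : Vec n → Vec N} (hφ : IsTestFun ⊤ (Metric.ball x r) φ) :
    0 ≤ ∫ y in Metric.ball x r, D2 g A (grad φ y) (grad φ y) := by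
  by_contra! hneg
  set I := ∫ y in Metric.ball x r, D2 g A (grad φ y) (grad φ y) with hI
  have h1 : ContDiff ℝ 1 φ := hφ.1.of_le (by exact_mod_cast le_top)
  have hc := continuous_grad h1
  obtain ⟨R, hR⟩ := exists_norm_grad_le h1 hφ.2.1
  have hR0 : 0 ≤ R := (norm_nonneg _).trans (hR x)
  set m := volume.real (Metric.ball x r) with hm
  have hm0 : 0 ≤ m := measureReal_nonneg
  -- Testing with `εφ`, the linear term integrates to zero and the rest is at most `ε²(I/2 + δR²m)`;
  -- this `δ` makes it negative.
  obtain ⟨δ, hδ, hδI⟩ : ∃ δ > 0, δ * (R ^ 2 * m) < -I / 2 := by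
    refine ⟨-I / 4 / (R ^ 2 * m + 1), by apply div_pos <;> [linarith; positivity], ?_⟩
    rw [div_mul_eq_mul_div, div_lt_iff₀ (by positivity)]
    nlinarith [mul_nonneg (sq_nonneg R) hm0]
  obtain ⟨s, hs, hT⟩ := exists_taylor_two_le hg A hδ
  set ε := s / (R + 1) with hε
  have hε0 : 0 < ε := by positivity
  have hεs : ε * R ≤ s := by
    rw [hε, div_mul_eq_mul_div, div_le_iff₀ (by positivity)]
    nlinarith
  have hq := hqc _ (hφ.const_smul ε)
  simp only [grad_const_smul] at hq
  have hgc : Continuous g := hg.continuous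
  have hpt : ∀ y ∈ Metric.ball x r, g (A + ε • grad φ y) - g A ≤
      (ε • fderiv ℝ g A) (grad φ y) + ε ^ 2 * 2⁻¹ * D2 g A (grad φ y) (grad φ y)
        + δ * ε ^ 2 * R ^ 2 := by
    intro y _
    have hn : ‖ε • grad φ y‖ ≤ ε * R := by
      rw [norm_smul, Real.norm_of_nonneg hε0.le]
      exact mul_le_mul_of_nonneg_left (hR y) hε0.le
    refine (hT _ (hn.trans hεs)).trans ?_
    have : ‖ε • grad φ y‖ ^ 2 ≤ (ε * R) ^ 2 := pow_le_pow_left₀ (norm_nonneg _) hn 2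
    have := mul_le_mul_of_nonneg_left this hδ.le
    simp only [map_smul, smul_apply, smul_eq_mul] at *
    nlinarith
  have hi1 : IntegrableOn (fun y => (ε • fderiv ℝ g A) (grad φ y)) (Metric.ball x r) :=
    Continuous.integrableOn_ball (by fun_prop) x r
  have hi2 : IntegrableOn (fun y => ε ^ 2 * 2⁻¹ * D2 g A (grad φ y) (grad φ y))
      (Metric.ball x r) := Continuous.integrableOn_ball (by fun_prop) x r
  have hi3 : IntegrableOn (fun _ : Vec n => δ * ε ^ 2 * R ^ 2) (Metric.ball x r) :=
    Continuous.integrableOn_ball (by fun_prop) x r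
  have hle := setIntegral_mono_on (Continuous.integrableOn_ball (by fun_prop) x r)
    ((hi1.add hi2).add hi3) measurableSet_ball hpt
  have e : ∫ y in Metric.ball x r, ((ε • fderiv ℝ g A) (grad φ y)
      + ε ^ 2 * 2⁻¹ * D2 g A (grad φ y) (grad φ y) + δ * ε ^ 2 * R ^ 2) =
      ε ^ 2 * 2⁻¹ * I + m * (δ * ε ^ 2 * R ^ 2) := by
    have e1 := integral_add (hi1.add hi2) hi3
    simp only [Pi.add_apply] at e1
    rw [e1, integral_add hi1 hi2, integral_const_mul,
      integral_clm_grad _ h1 hφ.2.1 hφ.2.2, setIntegral_const, smul_eq_mul, zero_add]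
  have hle' := hq.trans hle
  simp only [Pi.add_apply] at hle'
  rw [e] at hle'
  have : 0 < ε ^ 2 := by positivity
  nlinarith

/-- Legendre–Hadamard condition along the coordinate matrices. -/
theorem D2_single_nonneg (hg : ContDiff ℝ 2 g) {A : Hom n N} {x : Vec n} {r : ℝ} (hr : 0 < r)
    (hqc : ∀ φ : Vec n → Vec N, IsTestFun ⊤ (Metric.ball x r) φ →
      0 ≤ ∫ y in Metric.ball x r, (g (A + grad φ y) - g A)) (i : Fin N) (j : Fin n) :
    0 ≤ D2 g A (EuclideanSpace.single (i, j) 1) (EuclideanSpace.single (i, j) 1) := by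
  set E : Hom n N := EuclideanSpace.single (i, j) 1 with hE
  set Q := D2 g A with hQ
  by_contra! hneg
  let η : ContDiffBump x := ⟨r / 4, r / 2, by positivity, by linarith⟩
  -- Multiplying this bump by a function of the coordinate `y_j` alone adds to the gradient a
  -- multiple of the rank-one matrix `E`.
  let Φ : Vec n → Vec N := fun y => η y • EuclideanSpace.single i 1
  have hηs : ContDiff ℝ ((⊤ : ℕ∞) : WithTop ℕ∞) η := η.contDiff
  have hηsupp : tsupport η ⊆ Metric.ball x r := by
    rw [η.tsupport_eq]
    exact Metric.closedBall_subset_ball (by change r / 2 < r; linarith)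
  have hΦs : ContDiff ℝ ((⊤ : ℕ∞) : WithTop ℕ∞) Φ := hηs.smul contDiff_const
  have hΦ1 : ContDiff ℝ 1 Φ := hΦs.of_le (by exact_mod_cast le_top)
  have hGc := continuous_grad hΦ1
  have hsupp : ∀ c : Vec n → ℝ, tsupport (fun y => c y • Φ y) ⊆ tsupport η := by
    intro c
    apply closure_mono
    intro y hy
    simp only [Φ, Function.mem_support] at hy ⊢
    intro h
    simp [h] at hy
  have htest : ∀ c : Vec n → ℝ, ContDiff ℝ ((⊤ : ℕ∞) : WithTop ℕ∞) c →
      IsTestFun ⊤ (Metric.ball x r) fun y => c y • Φ y := fun c hc =>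
    ⟨hc.smul hΦs, η.hasCompactSupport.of_isClosed_subset (isClosed_tsupport _) (hsupp c),
      (hsupp c).trans hηsupp⟩
  let π : Vec n →L[ℝ] ℝ := EuclideanSpace.proj j
  have hgrad : ∀ (c : Vec n → ℝ) (d : ℝ) (y : Vec n), HasFDerivAt c (d • π) y →
      grad (fun y => c y • Φ y) y = c y • grad Φ y + (d * η y) • E := by
    intro c d y hc
    ext ⟨k, l⟩
    rw [grad_smul hc.differentiableAt (hΦ1.differentiable one_ne_zero y), hc.fderiv]
    simp only [Φ, E, π, PiLp.add_apply, PiLp.smul_apply, smul_eq_mul, smul_apply,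
      PiLp.single_apply, Prod.mk.injEq]
    by_cases hk : k = i <;> by_cases hl : j = l <;> simp [hk, hl, eq_comm]
  set a := ∫ y in Metric.ball x r, Q (grad Φ y) (grad Φ y) with ha
  set b := ∫ y in Metric.ball x r, η y ^ 2 with hb
  have hia : IntegrableOn (fun y => Q (grad Φ y) (grad Φ y)) (Metric.ball x r) :=
    Continuous.integrableOn_ball (by fun_prop) x r
  have hηc : Continuous η := η.continuous
  have hib : IntegrableOn (fun y => η y ^ 2) (Metric.ball x r) :=
    Continuous.integrableOn_ball (by fun_prop) x r
  have hbpos : 0 < b := by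
    rw [hb, setIntegral_pos_iff_support_of_nonneg_ae (Eventually.of_forall fun y => by positivity)
      hib]
    have : Metric.ball x (r / 2) ⊆ (Function.support fun y => η y ^ 2) ∩ Metric.ball x r := by
      intro y hy
      refine ⟨?_, Metric.ball_subset_ball (by linarith) hy⟩
      have : y ∈ Function.support η := by rw [η.support_eq]; exact hy
      simpa using this
    exact (Metric.measure_ball_pos volume x (by positivity)).trans_le (measure_mono this)
  -- The second variations for the multipliers `cos(k y_j)` and `sin(k y_j)` are added: the mixed
  -- terms cancel and `sin² + cos² = 1` removes the oscillation.
  have main : ∀ k : ℝ, 0 ≤ a + k ^ 2 * Q E E * b := by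
    intro k
    have hcos : ∀ y : Vec n, HasFDerivAt (fun y : Vec n => Real.cos (k * π y))
        ((-(Real.sin (k * π y) * k)) • π) y := fun y => by
      have := ((π.hasFDerivAt (x := y)).const_mul k).cos
      rwa [smul_smul, neg_mul] at this
    have hsin : ∀ y : Vec n, HasFDerivAt (fun y : Vec n => Real.sin (k * π y))
        ((Real.cos (k * π y) * k) • π) y := fun y => by
      have := ((π.hasFDerivAt (x := y)).const_mul k).sin
      rwa [smul_smul] at this
    have h1 := second_variation_nonneg hg hqc
      (htest (fun y => Real.cos (k * π y)) (by fun_prop))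
    have h2 := second_variation_nonneg hg hqc
      (htest (fun y => Real.sin (k * π y)) (by fun_prop))
    simp only [fun y => hgrad _ _ y (hcos y)] at h1
    simp only [fun y => hgrad _ _ y (hsin y)] at h2
    have h3 := add_nonneg h1 h2
    rw [← integral_add (Continuous.integrableOn_ball (by fun_prop) x r)
      (Continuous.integrableOn_ball (by fun_prop) x r)] at h3
    refine h3.trans_eq ?_
    rw [ha, hb, ← integral_const_mul, ← integral_add hia (hib.const_mul _)]
    congr 1
    ext y
    have hcs := Real.sin_sq_add_cos_sq (k * π y)
    simp only [map_add, map_smul, add_apply, smul_apply, smul_eq_mul, ← hQ]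
    linear_combination (Q (grad Φ y) (grad Φ y) + k ^ 2 * η y ^ 2 * Q E E) * hcs
  -- For this frequency the expression in `main` equals `-1`; frequency `0` gives `0 ≤ a`, so the
  -- radicand is nonnegative.
  have h := main (Real.sqrt ((a + 1) / (-(Q E E * b))))
  have hneg' : 0 < -(Q E E * b) := by nlinarith
  have h0 := main 0
  rw [Real.sq_sqrt (div_nonneg (by nlinarith) hneg'.le)] at h
  have : (a + 1) / (-(Q E E * b)) * (-(Q E E * b)) = a + 1 := div_mul_cancel₀ _ hneg'.ne'
  nlinarith

theorem add_fderiv_le_of_D2_nonneg (hg : ContDiff ℝ 2 g) {v : Hom n N}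
    (h : ∀ A, 0 ≤ D2 g A v v) (A : Hom n N) {s : ℝ} (hs : 0 < s) :
    g A + s * fderiv ℝ g A v ≤ g (A + s • v) := by
  have hmono : Monotone fun s : ℝ => fderiv ℝ g (A + s • v) v := by
    apply monotone_of_deriv_nonneg
    · exact fun s => (hasDerivAt_fderiv_line hg A v v s).differentiableAt
    · intro s
      rw [(hasDerivAt_fderiv_line hg A v v s).deriv]
      exact h _
  obtain ⟨c, hc, hc'⟩ := exists_hasDerivAt_eq_slope (fun s : ℝ => g (A + s • v))
    (fun s : ℝ => fderiv ℝ g (A + s • v) v) hs (by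
      have : Continuous g := hg.continuous
      fun_prop) (fun s _ => hasDerivAt_line hg A v s)
  have h2 := hmono hc.1.le
  simp only [zero_smul, add_zero, sub_zero] at h2 hc'
  rw [hc', le_div_iff₀ hs] at h2
  linarith

/-- Growth of the first derivative of a separately convex function of growth `p`. -/
theorem norm_fderiv_le_of_growth (hg : ContDiff ℝ 2 g)
    (hconv : ∀ (A : Hom n N) (i : Fin N) (j : Fin n),
      0 ≤ D2 g A (EuclideanSpace.single (i, j) 1) (EuclideanSpace.single (i, j) 1))
    {L p μ : ℝ} (hL : 0 ≤ L) (hp : 0 ≤ p) (hμ0 : 0 < μ) (hμ1 : μ ≤ 1) (hg0 : ∀ A, 0 ≤ g A)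
    (hgrowth : ∀ A, g A ≤ L * (μ ^ 2 + ‖A‖ ^ 2) ^ (p / 2)) (A : Hom n N) :
    ‖fderiv ℝ g A‖ ≤ N * n * (L * 3 ^ p) * (1 + ‖A‖) ^ (p - 1) := by
  set h := 1 + ‖A‖ with hh
  have hh0 : 0 < h := by positivity
  have hgE : ∀ E : Hom n N, ‖E‖ ≤ h → g (A + E) ≤ L * 3 ^ p * h ^ p := by
    intro E hE
    have hAE : ‖A + E‖ ≤ 2 * h := by
      have := norm_add_le A E
      linarith
    have h1 : μ ^ 2 + ‖A + E‖ ^ 2 ≤ (3 * h) ^ 2 := by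
      have := pow_le_pow_left₀ (norm_nonneg _) hAE 2
      have : 1 ≤ h := by linarith [norm_nonneg A]
      nlinarith
    calc g (A + E) ≤ L * (μ ^ 2 + ‖A + E‖ ^ 2) ^ (p / 2) := hgrowth _
      _ ≤ L * ((3 * h) ^ 2) ^ (p / 2) := by
        apply mul_le_mul_of_nonneg_left _ hL
        exact Real.rpow_le_rpow (by positivity) h1 (by linarith)
      _ = L * 3 ^ p * h ^ p := by
        rw [← Real.rpow_natCast, ← Real.rpow_mul (by positivity), mul_assoc,
          ← Real.mul_rpow (by norm_num) hh0.le]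
        congr 2
        push_cast
        ring
  -- Convexity along `v` with step `h = 1 + |A|` gives `h · Dg(A)v ≤ g(A + hv) ≤ C h^p`; dividing by
  -- `h` lowers the exponent to `p - 1`. Both `v` and `-v` are admissible.
  have hdir : ∀ v : Hom n N, ‖v‖ = 1 → (∀ A, 0 ≤ D2 g A v v) →
      fderiv ℝ g A v ≤ L * 3 ^ p * h ^ (p - 1) := by
    intro v hv hv2
    have h1 := add_fderiv_le_of_D2_nonneg hg hv2 A hh0
    have h2 := hgE (h • v) (by rw [norm_smul, hv, mul_one, Real.norm_of_nonneg hh0.le])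
    have h3 := hg0 A
    have e : L * 3 ^ p * h ^ (p - 1) = L * 3 ^ p * h ^ p / h := by
      rw [Real.rpow_sub_one hh0.ne']
      ring
    rw [e, le_div_iff₀ hh0]
    linarith
  refine (clm_norm_le_sum _).trans ?_
  have : ∀ ij : Fin N × Fin n, |fderiv ℝ g A (EuclideanSpace.single ij 1)| ≤
      L * 3 ^ p * h ^ (p - 1) := by
    rintro ⟨i, j⟩
    rw [abs_le']
    constructor
    · exact hdir _ (by simp) fun A => hconv A i j
    · rw [← map_neg]
      exact hdir _ (by simp) fun A => by simpa using hconv A i j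
  refine (Finset.sum_le_sum fun ij _ => this ij).trans_eq ?_
  simp [mul_assoc]

end SecondOrder

/-! ### Pointwise linearization at `A`. -/

section Taylor

variable {n N : ℕ} {g : Hom n N → ℝ} {M K : ℝ} {ν : ℝ → ℝ}

theorem norm_add_smul_sub_le {E : Type*} [NormedAddCommGroup E] [NormedSpace ℝ E] {A B : E}
    {R s : ℝ} (hA : ‖A‖ ≤ R) (hB : ‖B‖ ≤ R) (hs0 : 0 ≤ s) (hs1 : s ≤ 1) : ‖A + s • (B - A)‖ ≤ R := by
  have h := (convex_closedBall (0 : E) R).add_smul_sub_mem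
    (mem_closedBall_zero_iff.2 hA) (mem_closedBall_zero_iff.2 hB) ⟨hs0, hs1⟩
  exact mem_closedBall_zero_iff.1 h

theorem norm_sub_le_mul_of_norm_step_le {E : Type*} [SeminormedAddCommGroup E] (F : ℕ → E)
    (m : ℕ) (c : ℝ) (h : ∀ i < m, ‖F (i + 1) - F i‖ ≤ c) : ‖F m - F 0‖ ≤ m * c := by
  have := dist_le_range_sum_of_dist_le (f := F) (d := fun _ => c) m (by
    intro i hi
    rw [dist_eq_norm, norm_sub_rev]
    exact h i hi)
  simpa [dist_eq_norm, norm_sub_rev] using this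

theorem IsD2Modulus.nonneg (hν : IsD2Modulus g M ν) {A : Hom n N} (hA : ‖A‖ ≤ M + 1) {Φ : ℝ}
    (hΦ : 0 ≤ Φ) : 0 ≤ ν Φ := by
  have h1 := hν.bound A A hA hA
  rw [sub_self A, norm_zero] at h1
  exact (norm_nonneg (D2 g A - D2 g A)).trans (h1.trans (hν.mono self_mem_Ici hΦ hΦ))

/-- Subdividing a segment, a modulus of continuity on a ball controls large increments
linearly. -/
theorem IsD2Modulus.norm_sub_le_mul (hν : IsD2Modulus g M ν) {Φ : ℝ} (hΦ : 0 < Φ) {A B : Hom n N}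
    (hA : ‖A‖ ≤ M + 1) (hB : ‖B‖ ≤ M + 1) :
    ‖D2 g B - D2 g A‖ ≤ (1 + ‖B - A‖ / Φ) * ν Φ := by
  have hν0 : 0 ≤ ν Φ := hν.nonneg hA hΦ.le
  rcases eq_or_ne B A with rfl | hne
  · refine (hν.bound B B hA hA).trans ?_
    refine (hν.mono (norm_nonneg _) hΦ.le (by simpa using hΦ.le)).trans ?_
    simp
  have hd : 0 < ‖B - A‖ := norm_pos_iff.2 (sub_ne_zero.2 hne)
  -- The segment is cut into `m` pieces of length at most `Φ`; convexity keeps the nodes in the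
  -- ball, and each piece costs `ν Φ`.
  set m := ⌈‖B - A‖ / Φ⌉₊ with hm
  have hm0 : 0 < m := Nat.ceil_pos.2 (by positivity)
  have hm0' : (0 : ℝ) < m := by exact_mod_cast hm0
  have hm1 : (m : ℝ) ≤ 1 + ‖B - A‖ / Φ := by
    have := (Nat.ceil_lt_add_one (show 0 ≤ ‖B - A‖ / Φ by positivity)).le
    linarith
  have hm2 : ‖B - A‖ / m ≤ Φ := by
    have := Nat.le_ceil (‖B - A‖ / Φ)
    rw [div_le_iff₀ hΦ] at this
    rw [div_le_iff₀ hm0']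
    linarith
  have hP : ∀ i : ℕ, i ≤ m → ‖A + ((i : ℝ) / m) • (B - A)‖ ≤ M + 1 := fun i hi =>
    norm_add_smul_sub_le hA hB (by positivity)
      ((div_le_one hm0').2 (by exact_mod_cast hi))
  have h := norm_sub_le_mul_of_norm_step_le
    (fun i : ℕ => D2 g (A + ((i : ℝ) / m) • (B - A))) m (ν Φ) (by
      intro i hi
      refine (hν.bound _ _ (hP (i + 1) hi) (hP i hi.le)).trans ?_
      refine hν.mono (norm_nonneg _) hΦ.le (le_trans (le_of_eq ?_) hm2)
      rw [add_sub_add_left_eq_sub, ← sub_smul, norm_smul, ← sub_div, norm_div]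
      push_cast
      rw [add_sub_cancel_left, norm_one, Real.norm_of_nonneg hm0'.le]
      ring)
  simp only [Nat.cast_zero, zero_div, zero_smul, add_zero, div_self hm0'.ne', one_smul,
    add_sub_cancel] at h
  exact h.trans (mul_le_mul_of_nonneg_right hm1 hν0)

/-- Geometric mean of the bound by subdivision and the trivial bound `2K`; this is the source of
`√ν` in the theorem. -/
theorem IsD2Modulus.norm_sub_le_mul_sqrt (hν : IsD2Modulus g M ν)
    (hK : ∀ B : Hom n N, ‖B‖ ≤ M + 1 → ‖D2 g B‖ ≤ K) {Φ : ℝ} (hΦ : 0 < Φ) {A B : Hom n N}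
    (hA : ‖A‖ ≤ M + 1) (hB : ‖B‖ ≤ M + 1) :
    ‖D2 g B - D2 g A‖ ≤ (1 + ‖B - A‖ / Φ) * (Real.sqrt (2 * K) * Real.sqrt (ν Φ)) := by
  have h1 := hν.norm_sub_le_mul hΦ hA hB
  have h2 : ‖D2 g B - D2 g A‖ ≤ 2 * K := by
    have h3 := norm_sub_le (D2 g B) (D2 g A)
    have h4 := hK A hA
    have h5 := hK B hB
    exact h3.trans (by linarith)
  have hf : 1 ≤ 1 + ‖B - A‖ / Φ := by
    have : 0 ≤ ‖B - A‖ / Φ := by positivity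
    linarith
  have hK0 : 0 ≤ 2 * K := (norm_nonneg (D2 g B - D2 g A)).trans h2
  have hν0 : 0 ≤ ν Φ := hν.nonneg hA hΦ.le
  refine le_of_sq_le_sq ?_ (by positivity)
  rw [mul_pow, mul_pow, Real.sq_sqrt hK0, Real.sq_sqrt hν0, sq]
  calc _ ≤ (2 * K) * ((1 + ‖B - A‖ / Φ) * ν Φ) := mul_le_mul h2 h1 (norm_nonneg (D2 g B - D2 g A)) hK0
    _ = (1 + ‖B - A‖ / Φ) * (2 * K * ν Φ) := by ring
    _ ≤ (1 + ‖B - A‖ / Φ) ^ 2 * (2 * K * ν Φ) := by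
      apply mul_le_mul_of_nonneg_right _ (by positivity)
      nlinarith

/-- First-order expansion of `t ↦ g (ξ + t G)` with `Dg(ξ)` linearized at a nearby point `A`. -/
theorem sub_le_linearization (hg : ContDiff ℝ 2 g) (hν : IsD2Modulus g M ν)
    (hK : ∀ B : Hom n N, ‖B‖ ≤ M + 1 → ‖D2 g B‖ ≤ K) {Φ : ℝ} (hΦ : 0 < Φ) {A ξ G : Hom n N}
    (hA : ‖A‖ ≤ M) (hξ : ‖ξ - A‖ ≤ 1 / 2) (hG : ‖G‖ ≤ 1) {t : ℝ} (ht0 : 0 ≤ t)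
    (ht1 : t ≤ 1 / 2) :
    g (ξ + t • G) - g ξ ≤ t * (fderiv ℝ g A G + D2 g A (ξ - A) G) + K * t ^ 2 +
      t * (Real.sqrt (2 * K) * Real.sqrt (ν Φ)) * (‖ξ - A‖ + ‖ξ - A‖ ^ 2 / Φ) := by
  have hK0 : 0 ≤ K := (norm_nonneg (D2 g A)).trans (hK A (by linarith))
  have hξM : ‖ξ‖ ≤ M + 1 / 2 := by
    have := norm_sub_norm_le ξ A
    linarith
  have htG : ‖t • G‖ ≤ t := by
    rw [norm_smul, Real.norm_of_nonneg ht0]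
    exact mul_le_of_le_one_right ht0 hG
  have hξt : ‖ξ + t • G‖ ≤ M + 1 := by
    have := norm_add_le ξ (t • G)
    linarith
  have hseg : ∀ {P P' : Hom n N}, ‖P‖ ≤ M + 1 → ‖P'‖ ≤ M + 1 → ∀ B ∈ segment ℝ P P',
      ‖B‖ ≤ M + 1 ∧ ‖B - P‖ ≤ ‖P' - P‖ := by
    intro P P' h1 h2 B hB
    rw [segment_eq_image'] at hB
    obtain ⟨s, hs, rfl⟩ := hB
    refine ⟨norm_add_smul_sub_le h1 h2 hs.1 hs.2, ?_⟩
    simp only [add_sub_cancel_left, norm_smul, Real.norm_of_nonneg hs.1]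
    exact mul_le_of_le_one_left (norm_nonneg _) hs.2
  have hD : ∀ B, HasFDerivAt (fderiv ℝ g) (D2 g B) B := hasFDerivAt_fderiv hg
  -- Replacing `Dg` along the increment by `Dg(ξ)` costs `Kt`, hence `Kt²` in total. Replacing
  -- `Dg(ξ)` by its linearization at `A` is `s3`.
  have s1 : ∀ B ∈ segment ℝ ξ (ξ + t • G), ‖fderiv ℝ g B - fderiv ℝ g ξ‖ ≤ K * t := by
    intro B hB
    have hB1 := hseg (by linarith) hξt B hB
    have := (convex_segment ξ (ξ + t • G)).norm_image_sub_le_of_norm_hasFDerivWithin_le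
      (fun y _ => (hD y).hasFDerivWithinAt)
      (fun y hy => hK y (hseg (by linarith) hξt y hy).1) (left_mem_segment ℝ _ _) hB
    refine this.trans (mul_le_mul_of_nonneg_left (hB1.2.trans ?_) hK0)
    rwa [add_sub_cancel_left]
  have s2 := (convex_segment ξ (ξ + t • G)).norm_image_sub_le_of_norm_hasFDerivWithin_le'
    (φ := fderiv ℝ g ξ)
    (fun y _ => ((hg.differentiable two_ne_zero) y).hasFDerivAt.hasFDerivWithinAt) s1
    (left_mem_segment ℝ _ _) (right_mem_segment ℝ _ _)
  rw [add_sub_cancel_left] at s2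
  have s3 := (convex_segment A ξ).norm_image_sub_le_of_norm_hasFDerivWithin_le'
    (φ := D2 g A) (C := (1 + ‖ξ - A‖ / Φ) * (Real.sqrt (2 * K) * Real.sqrt (ν Φ)))
    (fun y _ => (hD y).hasFDerivWithinAt) (by
      intro B hB
      have hB1 := hseg (by linarith) (by linarith) B hB
      refine (hν.norm_sub_le_mul_sqrt hK hΦ (by linarith) hB1.1).trans ?_
      gcongr
      exact hB1.2)
    (left_mem_segment ℝ _ _) (right_mem_segment ℝ _ _)
  have s4 : fderiv ℝ g ξ G - fderiv ℝ g A G - D2 g A (ξ - A) G ≤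
      (1 + ‖ξ - A‖ / Φ) * (Real.sqrt (2 * K) * Real.sqrt (ν Φ)) * ‖ξ - A‖ := by
    have := (fderiv ℝ g ξ - fderiv ℝ g A - D2 g A (ξ - A)).le_of_opNorm_le s3 G
    simp only [sub_apply] at this
    refine (le_abs_self _).trans (this.trans (mul_le_of_le_one_right (by positivity) hG))
  have s5 := (le_abs_self _).trans s2
  rw [map_smul, smul_eq_mul] at s5
  have s6 : K * t * ‖t • G‖ ≤ K * t * t := mul_le_mul_of_nonneg_left htG (by positivity)
  have s7 := mul_le_mul_of_nonneg_left s4 ht0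
  have e : t * ((1 + ‖ξ - A‖ / Φ) * (Real.sqrt (2 * K) * Real.sqrt (ν Φ)) * ‖ξ - A‖) =
    t * (Real.sqrt (2 * K) * Real.sqrt (ν Φ)) * (‖ξ - A‖ + ‖ξ - A‖ ^ 2 / Φ) := by ring
  rw [e] at s7
  nlinarith

/-- Increments of a function whose derivative has growth `q - 1`. -/
theorem sub_le_of_norm_fderiv_le {F : Hom n N → ℝ} (hF : Differentiable ℝ F) {D q Q : ℝ}
    (hD : 0 ≤ D) (hq : 1 ≤ q) (hqQ : q ≤ Q)
    (hFD : ∀ B, ‖fderiv ℝ F B‖ ≤ D * (1 + ‖B‖) ^ (q - 1)) {ξ w : Hom n N} (hw : ‖w‖ ≤ 1) :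
    F (ξ + w) - F ξ ≤ D * 2 ^ Q * (1 + ‖ξ‖) ^ q * ‖w‖ := by
  have hb : ∀ B ∈ segment ℝ ξ (ξ + w), ‖fderiv ℝ F B‖ ≤ D * 2 ^ Q * (1 + ‖ξ‖) ^ q := by
    intro B hB
    rw [segment_eq_image'] at hB
    obtain ⟨s, hs, rfl⟩ := hB
    refine (hFD _).trans ?_
    rw [mul_assoc]
    apply mul_le_mul_of_nonneg_left _ hD
    have h1 : 1 + ‖ξ + s • (ξ + w - ξ)‖ ≤ 2 * (1 + ‖ξ‖) := by
      have h2 := norm_add_le ξ (s • (ξ + w - ξ))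
      have h3 : ‖s • (ξ + w - ξ)‖ ≤ 1 := by
        rw [add_sub_cancel_left, norm_smul, Real.norm_of_nonneg hs.1]
        exact mul_le_one₀ hs.2 (norm_nonneg _) hw
      linarith [norm_nonneg ξ]
    calc _ ≤ (2 * (1 + ‖ξ‖)) ^ (q - 1) :=
          Real.rpow_le_rpow (by positivity) h1 (by linarith)
      _ = 2 ^ (q - 1) * (1 + ‖ξ‖) ^ (q - 1) := Real.mul_rpow (by norm_num) (by positivity)
      _ ≤ _ := by
        apply mul_le_mul _ _ (by positivity) (by positivity)
        · exact Real.rpow_le_rpow_of_exponent_le (by norm_num) (by linarith)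
        · exact Real.rpow_le_rpow_of_exponent_le (by linarith [norm_nonneg ξ]) (by linarith)
  have := (convex_segment ξ (ξ + w)).norm_image_sub_le_of_norm_hasFDerivWithin_le
    (fun y _ => (hF y).hasFDerivAt.hasFDerivWithinAt) hb
    (left_mem_segment ℝ _ _) (right_mem_segment ℝ _ _)
  rw [add_sub_cancel_left] at this
  exact (le_abs_self _).trans this

/-- Pointwise comparison of `F (ξ + t G)` with `F ξ`, where `F` is close to `g` on a ball, by the
linearization of `Dg` at `A`; the error is measured by `V`. -/
theorem le_add_linearization (hg : ContDiff ℝ 2 g) (hν : IsD2Modulus g M ν)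
    (hK : ∀ B : Hom n N, ‖B‖ ≤ M + 1 → ‖D2 g B‖ ≤ K) {F : Hom n N → ℝ} (hF : Differentiable ℝ F)
    {D q Q κ : ℝ} (hD : 0 ≤ D) (hq : 1 ≤ q) (hqQ : q ≤ Q)
    (hFD : ∀ B, ‖fderiv ℝ F B‖ ≤ D * (1 + ‖B‖) ^ (q - 1))
    (hgD : ∀ B, ‖fderiv ℝ g B‖ ≤ D * (1 + ‖B‖) ^ (q - 1))
    (hκ0 : 0 ≤ κ) (hFg : ∀ B : Hom n N, ‖B‖ ≤ M + 1 → |F B - g B| ≤ κ)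
    {Φ : ℝ} (hΦ : 0 < Φ) {A ξ G : Hom n N} (hA : ‖A‖ ≤ M) (hG : ‖G‖ ≤ 1) {t : ℝ} (ht0 : 0 ≤ t)
    (ht1 : t ≤ 1 / 2) :
    F (ξ + t • G) ≤ F ξ + (t * (fderiv ℝ g A G + D2 g A (ξ - A) G) + (K * t ^ 2 + 2 * κ) +
      t * ((Real.sqrt (2 * K) * Real.sqrt (ν Φ)) * (4 * (2 + M)) *
        (Φ + 2 / Φ * ‖V q ξ - V q A‖ ^ 2)) +
      t * ((D * 2 ^ Q + D * (1 + M) ^ Q + K * (1 + M)) *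
        (4 * ((1 + M) * 2 ^ Q) * (3 + 2 * M) ^ 2) * ‖V q ξ - V q A‖ ^ 2)) := by
  have hM : 0 ≤ M := (norm_nonneg A).trans hA
  have hK0 : 0 ≤ K := (norm_nonneg (D2 g A)).trans (hK A (by linarith))
  set h := ‖V q ξ - V q A‖ with hh
  set m := Real.sqrt (2 * K) * Real.sqrt (ν Φ) with hm
  have hm0 : 0 ≤ m := by positivity
  have hh0 : 0 ≤ h := norm_nonneg _
  set C₃ := (D * 2 ^ Q + D * (1 + M) ^ Q + K * (1 + M)) with hC₃
  have hC₃0 : 0 ≤ C₃ := by positivity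
  have htG : ‖t • G‖ ≤ t := by
    rw [norm_smul, Real.norm_of_nonneg ht0]
    exact mul_le_of_le_one_right ht0 hG
  -- In the near case both `ξ` and `ξ + tG` lie in the ball where `F` may be exchanged for `g`, at
  -- cost `κ` each. In the far case only the growth of `DF` is used.
  rcases le_total ‖ξ - A‖ (1 / 2) with hn | hf
  · have h1 := sub_le_linearization hg hν hK hΦ hA hn hG ht0 ht1
    have h2 := norm_sub_sq_le_V_sub_sq hq hA hn
    have h3 : ‖ξ - A‖ + ‖ξ - A‖ ^ 2 / Φ ≤ 4 * (2 + M) * (Φ + 2 / Φ * h ^ 2) := by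
      -- Young's inequality with weight `Φ`: a first power becomes a square, whose mean is
      -- controlled by the excess.
      have h4 : ‖ξ - A‖ ≤ Φ + ‖ξ - A‖ ^ 2 / Φ := by
        have : 0 ≤ (‖ξ - A‖ - Φ) ^ 2 / Φ := by positivity
        have e : (‖ξ - A‖ - Φ) ^ 2 / Φ = ‖ξ - A‖ ^ 2 / Φ - 2 * ‖ξ - A‖ + Φ := by
          field_simp
          ring
        linarith [norm_nonneg (ξ - A)]
      have h5 : ‖ξ - A‖ ^ 2 / Φ ≤ 4 * (2 + M) * h ^ 2 / Φ := by gcongr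
      have e : 4 * (2 + M) * (Φ + 2 / Φ * h ^ 2) =
        4 * (2 + M) * Φ + 2 * (4 * (2 + M) * h ^ 2 / Φ) := by ring
      rw [e]
      nlinarith
    have h4 : t * m * (‖ξ - A‖ + ‖ξ - A‖ ^ 2 / Φ) ≤
        t * m * (4 * (2 + M) * (Φ + 2 / Φ * h ^ 2)) :=
      mul_le_mul_of_nonneg_left h3 (by positivity)
    have hξM : ‖ξ‖ ≤ M + 1 / 2 := by
      have := norm_sub_norm_le ξ A
      linarith
    have hξt : ‖ξ + t • G‖ ≤ M + 1 := by
      have := norm_add_le ξ (t • G)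
      linarith
    have h5 := (abs_le.1 (hFg _ hξt)).2
    have h6 := (abs_le.1 (hFg ξ (by linarith))).1
    have h7 : 0 ≤ t * (C₃ * (4 * ((1 + M) * 2 ^ Q) * (3 + 2 * M) ^ 2) * h ^ 2) := by positivity
    linarith
  · have h1 := sub_le_of_norm_fderiv_le hF hD hq hqQ hFD (ξ := ξ) (w := t • G) (by linarith)
    have h2 := one_add_norm_rpow_le_V_sub_sq hq hqQ hA hf
    set Z := (1 + ‖ξ‖) ^ q with hZ
    have hZ1 : 1 + ‖ξ‖ ≤ Z := by
      have := Real.rpow_le_rpow_of_exponent_le (show 1 ≤ 1 + ‖ξ‖ by linarith [norm_nonneg ξ]) hq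
      rwa [Real.rpow_one] at this
    have hZ0 : 0 ≤ Z := by positivity
    have h3 : F (ξ + t • G) - F ξ ≤ t * (D * 2 ^ Q * Z) := by
      refine h1.trans ?_
      rw [mul_comm t]
      exact mul_le_mul_of_nonneg_left htG (by positivity)
    -- The linearization also stands on the right in the far case, where it may be negative; `h4`
    -- and `h5` absorb it into `Z`. This accounts for the last two summands of `C₃`.
    have h4 : -(fderiv ℝ g A G) ≤ D * (1 + M) ^ Q * Z := by
      have a1 := (fderiv ℝ g A).le_of_opNorm_le (hgD A) G
      have a2 : (1 + ‖A‖) ^ (q - 1) ≤ (1 + M) ^ Q :=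
        (Real.rpow_le_rpow (by positivity) (by linarith) (by linarith)).trans
          (Real.rpow_le_rpow_of_exponent_le (by linarith) (by linarith))
      calc _ ≤ ‖fderiv ℝ g A G‖ := neg_le_abs _
        _ ≤ D * (1 + ‖A‖) ^ (q - 1) * ‖G‖ := a1
        _ ≤ D * (1 + M) ^ Q * Z := by
          apply mul_le_mul _ _ (norm_nonneg _) (by positivity)
          · exact mul_le_mul_of_nonneg_left a2 hD
          · linarith [norm_nonneg ξ]
    have h5 : -(D2 g A (ξ - A) G) ≤ K * (1 + M) * Z := by
      have a1 := (D2 g A).le_opNorm₂ (ξ - A) G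
      have a2 : ‖ξ - A‖ ≤ (1 + M) * Z := by
        have := norm_sub_le ξ A
        nlinarith [norm_nonneg ξ]
      calc _ ≤ ‖D2 g A (ξ - A) G‖ := neg_le_abs _
        _ ≤ ‖D2 g A‖ * ‖ξ - A‖ * ‖G‖ := a1
        _ ≤ K * ((1 + M) * Z) * 1 := by
          gcongr
          exact hK A (by linarith)
        _ = _ := by ring
    have h6 : 0 ≤ t * (m * (4 * (2 + M)) * (Φ + 2 / Φ * h ^ 2)) := by positivity
    have h7 : t * (C₃ * Z) ≤
        t * (C₃ * (4 * ((1 + M) * 2 ^ Q) * (3 + 2 * M) ^ 2) * h ^ 2) := by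
      rw [mul_assoc C₃]
      exact mul_le_mul_of_nonneg_left (mul_le_mul_of_nonneg_left h2 hC₃0) ht0
    have h8 := mul_le_mul_of_nonneg_left (add_le_add h4 h5) ht0
    have h9 : 0 ≤ K * t ^ 2 + 2 * κ := by positivity
    have e : t * (C₃ * Z) = t * (D * 2 ^ Q * Z) +
      t * (D * (1 + M) ^ Q * Z + K * (1 + M) * Z) := by
      rw [hC₃]
      ring
    linarith

end Taylor

/-! ### Consequences of the structure conditions. -/

/-- For `X ≤ 1` the power absorbs the logarithm, as `√X |log X| ≤ 2`. The bound is therefore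
independent of `μ` when `X = μ² + |B|²`. -/
theorem rpow_mul_one_add_abs_log_le {X R p Q : ℝ} (hX : 0 < X) (hXR : X ≤ R) (hR : 1 ≤ R)
    (hp : 1 ≤ p) (hpQ : p ≤ Q) :
    X ^ (p / 2) * (1 + |Real.log X|) ≤ 3 * R ^ (Q / 2) * (1 + R) := by
  have hRQ : 1 ≤ R ^ (Q / 2) := Real.one_le_rpow hR (by linarith)
  rcases le_total X 1 with h1 | h1
  · have h2 : X ^ (p / 2) ≤ X ^ (1 / 2 : ℝ) :=
      Real.rpow_le_rpow_of_exponent_ge hX h1 (by linarith)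
    have h3 := (Real.abs_log_mul_self_rpow_lt X (1 / 2) hX h1 (by norm_num)).le
    rw [abs_mul, abs_of_nonneg (show 0 ≤ X ^ (1 / 2 : ℝ) by positivity)] at h3
    have h4 : X ^ (1 / 2 : ℝ) ≤ 1 := Real.rpow_le_one hX.le h1 (by norm_num)
    calc X ^ (p / 2) * (1 + |Real.log X|) ≤ X ^ (1 / 2 : ℝ) * (1 + |Real.log X|) :=
          mul_le_mul_of_nonneg_right h2 (by positivity)
      _ ≤ 3 := by
          norm_num at h3
          nlinarith
      _ ≤ _ := by nlinarith
  · have h2 : X ^ (p / 2) ≤ R ^ (Q / 2) :=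
      (Real.rpow_le_rpow hX.le hXR (by linarith)).trans
        (Real.rpow_le_rpow_of_exponent_le hR (by linarith))
    have h3 : |Real.log X| ≤ R := by
      rw [abs_of_nonneg (Real.log_nonneg h1)]
      linarith [Real.log_le_sub_one_of_pos hX]
    calc _ ≤ R ^ (Q / 2) * (1 + R) := by gcongr
      _ ≤ _ := by nlinarith

namespace StructureConditions

variable {n N : ℕ} {Ω : Set (Vec n)} {f : Vec n → Hom n N → ℝ} {p : Vec n → ℝ} {ω : ℝ → ℝ}
  {μ L α : ℝ}

theorem one_lt_exponent (h : StructureConditions Ω f p ω μ L α) {x : Vec n} (hx : x ∈ Ω) :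
    1 < p x := by
  obtain ⟨γ₁, γ₂, h1, h2⟩ := h.p_bounds
  exact h1.trans_le (h2 x hx).1

theorem integrand_nonneg (h : StructureConditions Ω f p ω μ L α) (hL : 1 ≤ L) {x : Vec n}
    (hx : x ∈ Ω) (A : Hom n N) : 0 ≤ f x A :=
  le_trans (by positivity) (h.growth x hx A).1

/-- Quasi-convexity and growth of order `p x ≤ q` bound the first derivative. -/
theorem norm_fderiv_le (h : StructureConditions Ω f p ω μ L α) (hL : 1 ≤ L) (hΩ : IsOpen Ω)
    {x : Vec n} (hx : x ∈ Ω) {q Q : ℝ} (hq : p x ≤ q) (hQ : q ≤ Q) (A : Hom n N) :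
    ‖fderiv ℝ (f x) A‖ ≤ N * n * (L * 3 ^ Q) * (1 + ‖A‖) ^ (q - 1) := by
  obtain ⟨r, hr, hball⟩ := Metric.nhds_basis_closedBall.mem_iff.1 (hΩ.mem_nhds hx)
  have hp := h.one_lt_exponent hx
  have h1 := norm_fderiv_le_of_growth (h.smooth x hx) (fun B i j =>
    D2_single_nonneg (h.smooth x hx) hr (fun φ hφ =>
      le_trans (mul_nonneg (by positivity) (setIntegral_nonneg measurableSet_ball
        fun y _ => by positivity)) (h.quasiconvex x hx r hr hball B φ hφ)) i j)
    (zero_le_one.trans hL) (by linarith) h.mu_pos h.mu_le (h.integrand_nonneg hL hx)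
    (fun A => (h.growth x hx A).2) A
  refine h1.trans ?_
  have hA : 1 ≤ 1 + ‖A‖ := by linarith [norm_nonneg A]
  gcongr
  · norm_num
  · exact hq.trans hQ

theorem abs_sub_le (h : StructureConditions Ω f p ω μ L α) (hL : 1 ≤ L) {x y : Vec n}
    (hx : x ∈ Ω) (hy : y ∈ Ω) {Q M ρ : ℝ} (hxQ : p x ≤ Q) (hyQ : p y ≤ Q) (hρ : dist x y < ρ)
    {B : Hom n N} (hB : ‖B‖ ≤ M) :
    |f x B - f y B| ≤ 6 * L * ((1 + M ^ 2) ^ (Q / 2) * (2 + M ^ 2)) * ω ρ := by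
  have hρ0 : 0 < ρ := dist_nonneg.trans_lt hρ
  have hω := h.omega_modulus.pos ρ hρ0
  rcases eq_or_ne x y with rfl | hne
  · rw [sub_self, abs_zero]
    positivity
  have hd : 0 < dist x y := dist_pos.2 hne
  have hX : 0 < μ ^ 2 + ‖B‖ ^ 2 := by
    have := h.mu_pos
    positivity
  have hXR : μ ^ 2 + ‖B‖ ^ 2 ≤ 1 + M ^ 2 := by
    have h1 := pow_le_pow_left₀ (norm_nonneg B) hB 2
    have h2 := pow_le_one₀ (n := 2) h.mu_pos.le h.mu_le
    linarith
  have hR : (1 : ℝ) ≤ 1 + M ^ 2 := by nlinarith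
  have e1 := rpow_mul_one_add_abs_log_le hX hXR hR (h.one_lt_exponent hx).le hxQ
  have e2 := rpow_mul_one_add_abs_log_le hX hXR hR (h.one_lt_exponent hy).le hyQ
  have hmono : ω (dist x y) ≤ ω ρ := h.omega_modulus.mono hd hρ0 hρ.le
  refine (h.continuity x hx y hy hne B).trans ?_
  set l := 1 + |Real.log (μ ^ 2 + ‖B‖ ^ 2)|
  calc _ = L * ω (dist x y) * ((μ ^ 2 + ‖B‖ ^ 2) ^ (p x / 2) * l +
        (μ ^ 2 + ‖B‖ ^ 2) ^ (p y / 2) * l) := by ring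
    _ ≤ L * ω ρ * (3 * (1 + M ^ 2) ^ (Q / 2) * (1 + (1 + M ^ 2)) +
        3 * (1 + M ^ 2) ^ (Q / 2) * (1 + (1 + M ^ 2))) := by
      gcongr
    _ = _ := by ring

/-- Finiteness allows the energy of `u` to be cancelled from the minimality inequality in `ENNReal`.
-/
theorem energy_lt_top (h : StructureConditions Ω f p ω μ L α) (hL : 1 ≤ L) (hΩ : IsOpen Ω)
    (hb : Bornology.IsBounded Ω) {G : Vec n → Hom n N}
    (hG : IntegrableOn (fun x => ‖G x‖ ^ p x) Ω) : energy Ω f G < ⊤ := by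
  obtain ⟨γ₁, γ₂, h1, h2⟩ := h.p_bounds
  have hi : IntegrableOn (fun x => L * 2 ^ γ₂ * (1 + ‖G x‖ ^ p x)) Ω :=
    ((integrableOn_const hb.measure_lt_top.ne).add hG).const_mul _
  refine lt_of_le_of_lt ?_ hi.lintegral_lt_top
  apply setLIntegral_mono' hΩ.measurableSet
  intro x hx
  apply ENNReal.ofReal_le_ofReal
  refine (h.growth x hx (G x)).2.trans ?_
  rw [mul_assoc]
  have hp := h.one_lt_exponent hx
  apply mul_le_mul_of_nonneg_left _ (by linarith)
  have hμ : μ ^ 2 ≤ 1 := pow_le_one₀ h.mu_pos.le h.mu_le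
  calc (μ ^ 2 + ‖G x‖ ^ 2) ^ (p x / 2) ≤ (1 + ‖G x‖ ^ 2) ^ (p x / 2) := by gcongr
    _ ≤ 2 ^ p x * (1 + ‖G x‖ ^ p x) := one_add_sq_rpow_half_le (by linarith) (norm_nonneg _)
    _ ≤ _ := by
      gcongr
      · norm_num
      · exact (h2 x hx).2

end StructureConditions

/-! ### Minimality and integration of the error terms. -/

/-- If a pointwise bound `f(x, Du + Dφ) ≤ f(x, Du) + d` holds on a set containing the support of
the variation `φ`, then minimality gives `0 ≤ ∫ d`. -/
theorem IsLocalMinimizer.integral_nonneg {n N : ℕ} {Ω : Set (Vec n)} {f : Vec n → Hom n N → ℝ}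
    {p : Vec n → ℝ} {u : Vec n → Vec N} {Du : Vec n → Hom n N} (hu : IsLocalMinimizer Ω f p u Du)
    (hfin : energy Ω f Du < ⊤) (hΩ : MeasurableSet Ω) (hf : ∀ x ∈ Ω, ∀ A, 0 ≤ f x A)
    {U : Set (Vec n)} (hU : MeasurableSet U) (hUΩ : U ⊆ Ω) {φ : Vec n → Vec N}
    (hφ : IsTestFun 1 U φ) {d : Vec n → ℝ} (hd : IntegrableOn d U)
    (hle : ∀ x ∈ U, f x (Du x + grad φ x) ≤ f x (Du x) + d x) :
    0 ≤ ∫ x in U, d x := by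
  have hmin := hu.minimal φ (grad φ)
    (IsTestFun.isSobolevCompact ⟨hφ.1, hφ.2.1, hφ.2.2.trans hUΩ⟩)
  unfold energy at hmin hfin
  have hsplit := fun F : Vec n → ENNReal => lintegral_inter_add_sdiff (μ := volume) F Ω hU
  rw [inter_eq_self_of_subset_right hUΩ] at hsplit
  rw [← hsplit] at hfin
  rw [← hsplit, ← hsplit (fun x => ENNReal.ofReal (f x (Du x + grad φ x)))] at hmin
  have hout : ∫⁻ x in Ω \ U, ENNReal.ofReal (f x (Du x + grad φ x)) =
      ∫⁻ x in Ω \ U, ENNReal.ofReal (f x (Du x)) := by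
    apply setLIntegral_congr_fun (hΩ.diff hU)
    intro x hx
    simp only [grad_eq_zero_of_notMem fun h => hx.2 (hφ.2.2 h), add_zero]
  rw [hout] at hmin
  have hfin1 := (ENNReal.add_lt_top.1 hfin).1
  have hfin2 := (ENNReal.add_lt_top.1 hfin).2
  have hminU := (ENNReal.add_le_add_iff_right hfin2.ne).1 hmin
  have hdm : AEMeasurable d (volume.restrict U) := hd.aemeasurable
  have hdn : AEMeasurable (fun x => -d x) (volume.restrict U) := hdm.neg
  -- Adding the negative part of `d` on both sides avoids subtraction in `ENNReal`. Additivity of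
  -- the integral is used only with a measurable second summand, so measurability of `d` is enough.
  have key : (∫⁻ x in U, ENNReal.ofReal (f x (Du x))) + ∫⁻ x in U, ENNReal.ofReal (-d x) ≤
      (∫⁻ x in U, ENNReal.ofReal (f x (Du x))) + ∫⁻ x in U, ENNReal.ofReal (d x) := by
    refine (add_le_add_left hminU _).trans ?_
    rw [← lintegral_add_right' _ hdn.ennreal_ofReal,
      ← lintegral_add_right' _ hdm.ennreal_ofReal]
    apply setLIntegral_mono' hU
    intro x hx
    have h1 := hf x (hUΩ hx) (Du x)
    have h2 := hf x (hUΩ hx) (Du x + grad φ x)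
    have h3 := hle x hx
    rcases le_total 0 (d x) with h | h
    · rw [ENNReal.ofReal_of_nonpos (neg_nonpos.2 h), add_zero,
        ← ENNReal.ofReal_add h1 h]
      exact ENNReal.ofReal_le_ofReal h3
    · rw [ENNReal.ofReal_of_nonpos h, add_zero,
        ← ENNReal.ofReal_add h2 (neg_nonneg.2 h)]
      exact ENNReal.ofReal_le_ofReal (by linarith)
  have key2 := (ENNReal.add_le_add_iff_left hfin1.ne).1 key
  rw [integral_eq_lintegral_pos_part_sub_lintegral_neg_part hd, sub_nonneg]
  exact ENNReal.toReal_mono hd.lintegral_lt_top.ne key2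

theorem volume_real_ball_two_mul {n : ℕ} (x : Vec n) (ρ : ℝ) :
    volume.real (Metric.ball x (2 * ρ)) = 2 ^ n * volume.real (Metric.ball x ρ) := by
  rw [Measure.real, Measure.addHaar_ball_mul_of_pos volume x two_pos, ENNReal.toReal_mul,
    ENNReal.toReal_ofReal (by positivity), finrank_euclideanSpace, Fintype.card_fin,
    Measure.real, Measure.addHaar_ball_center volume x]

theorem integrableOn_V_sub_sq {n N : ℕ} {Du : Vec n → Hom n N} {U : Set (Vec n)}
    (hU : volume U ≠ ⊤) {q : ℝ} (hq : 0 ≤ q)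
    (hm : AEStronglyMeasurable Du (volume.restrict U))
    (hi : IntegrableOn (fun x => ‖Du x‖ ^ q) U) (A : Hom n N) :
    IntegrableOn (fun x => ‖V q (Du x) - V q A‖ ^ 2) U := by
  have hg : IntegrableOn (fun x => 2 * (2 ^ q * (1 + ‖Du x‖ ^ q)) + 2 * ‖V q A‖ ^ 2) U :=
    ((((integrableOn_const hU).add hi).const_mul _).const_mul _).add (integrableOn_const hU)
  refine Integrable.mono' hg ?_ (Eventually.of_forall fun x => ?_)
  · exact ((((continuous_V q).comp_aestronglyMeasurable hm).sub
      aestronglyMeasurable_const).norm.pow 2)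
  · rw [Real.norm_of_nonneg (by positivity)]
    have h1 := norm_V_sq_le hq (Du x)
    have h2 := norm_sub_le (V q (Du x)) (V q A)
    have h3 := pow_le_pow_left₀ (norm_nonneg _) h2 2
    nlinarith [sq_nonneg (‖V q (Du x)‖ - ‖V q A‖)]

theorem integrableOn_clm_apply_grad {n N : ℕ} {G : Vec n → Hom n N} {U : Set (Vec n)}
    (hG : IntegrableOn G U) (T : Hom n N →L[ℝ] Hom n N →L[ℝ] ℝ) {φ : Vec n → Vec N}
    (hφ : ContDiff ℝ 1 φ) {R : ℝ} (hR : ∀ x, ‖grad φ x‖ ≤ R) :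
    IntegrableOn (fun x => T (G x) (grad φ x)) U := by
  refine Integrable.mono' (hG.norm.const_mul (‖T‖ * R)) ?_ (Eventually.of_forall fun x => ?_)
  · exact T.aestronglyMeasurable_comp₂ hG.aestronglyMeasurable
      (continuous_grad hφ).aestronglyMeasurable
  · refine (T.le_opNorm₂ (G x) (grad φ x)).trans ?_
    calc ‖T‖ * ‖G x‖ * ‖grad φ x‖ ≤ ‖T‖ * ‖G x‖ * R :=
          mul_le_mul_of_nonneg_left (hR x) (by positivity)
      _ = _ := by ring

/-- The integrand has the shape of the right-hand side in `le_add_linearization`, with `h` the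
squared `V`-distance. -/
theorem setIntegral_error_terms {n : ℕ} {U : Set (Vec n)} (hU : volume U ≠ ⊤)
    {a b h : Vec n → ℝ} (ha : IntegrableOn a U) (hb : IntegrableOn b U) (hh : IntegrableOn h U)
    (t c m Φ k C : ℝ) :
    IntegrableOn (fun x => t * (a x + b x) + c + t * (m * (Φ + k * h x)) + t * (C * h x)) U ∧
    ∫ x in U, (t * (a x + b x) + c + t * (m * (Φ + k * h x)) + t * (C * h x)) =
      t * (∫ x in U, a x) + t * (∫ x in U, b x) + volume.real U * c +
        t * (m * (volume.real U * Φ + k * ∫ x in U, h x)) + t * (C * ∫ x in U, h x) := by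
  have e : (fun x => t * (a x + b x) + c + t * (m * (Φ + k * h x)) + t * (C * h x)) =
      fun x => t * a x + (t * b x + ((c + t * m * Φ) + (t * m * k + t * C) * h x)) := by
    ext x
    ring
  have ic : IntegrableOn (fun _ : Vec n => c + t * m * Φ) U := integrableOn_const hU
  have h3 := ic.add (hh.const_mul (t * m * k + t * C))
  have h2 := (hb.const_mul t).add h3
  have h1 := (ha.const_mul t).add h2
  refine ⟨by rw [e]; exact h1, ?_⟩
  rw [e]
  have e1 := integral_add (ha.const_mul t) h2
  have e2 := integral_add (hb.const_mul t) h3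
  have e3 := integral_add ic (hh.const_mul (t * m * k + t * C))
  simp only [Pi.add_apply] at e1 e2 e3
  rw [e1, e2, e3, integral_const_mul, integral_const_mul, integral_const_mul, setIntegral_const,
    smul_eq_mul]
  ring

/-- Division by `vt`: the quadratic errors in `t` become linear, and `H ≤ vΦ²` turns the weight
`2/Φ` into `2vΦ`. -/
theorem neg_inv_mul_le_of_error_terms {v t Φ I H m C K κ : ℝ} (hv : 0 < v) (ht : 0 < t)
    (hΦ : 0 < Φ) (hm : 0 ≤ m) (hC : 0 ≤ C) (hH : H ≤ v * Φ ^ 2)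
    (h : 0 ≤ t * I + v * (K * t ^ 2 + 2 * (κ * t ^ 2)) + t * (m * (v * Φ + 2 / Φ * H)) +
      t * (C * H)) :
    -(v⁻¹ * I) ≤ (K + 2 * κ) * t + 3 * m * Φ + C * Φ ^ 2 := by
  have h1 : 2 / Φ * H ≤ 2 * (v * Φ) := by
    rw [div_mul_eq_mul_div, div_le_iff₀ hΦ]
    linarith
  have h2 : m * (v * Φ + 2 / Φ * H) ≤ m * (3 * (v * Φ)) :=
    mul_le_mul_of_nonneg_left (by linarith) hm
  have h3 : C * H ≤ C * (v * Φ ^ 2) := mul_le_mul_of_nonneg_left hH hC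
  have h4 : 0 ≤ t * (I + v * ((K + 2 * κ) * t) + m * (3 * (v * Φ)) + C * (v * Φ ^ 2)) := by
    have := mul_le_mul_of_nonneg_left (add_le_add h2 h3) ht.le
    linarith
  have h5 := nonneg_of_mul_nonneg_right h4 ht
  rw [← mul_neg, inv_mul_le_iff₀ hv]
  linarith

/-! ### The averaged estimate and the theorem. -/

section Main

variable {n N : ℕ} {Ω : Set (Vec n)} {f : Vec n → Hom n N → ℝ} {p : Vec n → ℝ} {ω : ℝ → ℝ}
  {μ L α : ℝ} {u : Vec n → Vec N} {Du : Vec n → Hom n N}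

/-- One-sided estimate for normalized test functions and small `ω ρ`. -/
theorem neg_setAverage_D2_le (hL : 1 ≤ L) (hΩ : IsOpen Ω) (hb : Bornology.IsBounded Ω)
    (hs : StructureConditions Ω f p ω μ L α) (hu : IsLocalMinimizer Ω f p u Du)
    (hint : IntegrableOn (fun x => ‖Du x‖ ^ p x) Ω) {x₀ : Vec n} {ρ : ℝ} (hρ : 0 < ρ)
    (hball : Metric.closedBall x₀ ρ ⊆ Ω) {q Q : ℝ} (hq : 1 ≤ q) (hqQ : q ≤ Q)
    (hpq : ∀ x ∈ Metric.ball x₀ ρ, p x ≤ q)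
    (hDq : IntegrableOn (fun x => ‖Du x‖ ^ q) (Metric.ball x₀ ρ)) {M K : ℝ}
    (hK : ∀ B : Hom n N, ‖B‖ ≤ M + 1 → ‖D2 (f x₀) B‖ ≤ K) {ν : ℝ → ℝ}
    (hν : IsD2Modulus (f x₀) M ν) {A : Hom n N} (hA : ‖A‖ ≤ M) {φ : Vec n → Vec N}
    (hφ : IsTestFun 1 (Metric.ball x₀ ρ) φ) (hφ1 : ∀ x ∈ Metric.ball x₀ ρ, ‖grad φ x‖ ≤ 1)
    (hω : Real.sqrt (ω ρ) ≤ 1 / 2) {Φ : ℝ} (hΦ : 0 < Φ)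
    (hΦ2 : ⨍ x in Metric.ball x₀ ρ, ‖V q (Du x) - V q A‖ ^ 2 ≤ Φ ^ 2) :
    -(⨍ x in Metric.ball x₀ ρ, D2 (f x₀) A (Du x - A) (grad φ x)) ≤
      (K + 12 * L * ((1 + (M + 1) ^ 2) ^ (Q / 2) * (2 + (M + 1) ^ 2))) * Real.sqrt (ω ρ) +
      12 * (2 + M) * Real.sqrt (2 * K) * (Real.sqrt (ν Φ) * Φ) +
      (N * n * (L * 3 ^ Q) * 2 ^ Q + N * n * (L * 3 ^ Q) * (1 + M) ^ Q + K * (1 + M)) *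
        (4 * ((1 + M) * 2 ^ Q) * (3 + 2 * M) ^ 2) * Φ ^ 2 := by
  have hL0 : 0 ≤ L := zero_le_one.trans hL
  have hx₀ : x₀ ∈ Ω := hball (Metric.mem_closedBall_self hρ.le)
  set U := Metric.ball x₀ ρ with hU
  have hUΩ : U ⊆ Ω := Metric.ball_subset_closedBall.trans hball
  have hUfin : volume U ≠ ⊤ := measure_ball_lt_top.ne
  have hM : 0 ≤ M := (norm_nonneg A).trans hA
  set D : ℝ := N * n * (L * 3 ^ Q) with hD
  set κ₀ := 6 * L * ((1 + (M + 1) ^ 2) ^ (Q / 2) * (2 + (M + 1) ^ 2)) with hκ₀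
  -- This step size makes the freezing error `κ₀ ω(ρ)` equal to `κ₀ t²`, of the same order as the
  -- Taylor error `Kt²`.
  set t := Real.sqrt (ω ρ) with ht
  have hωpos := hs.omega_modulus.pos ρ hρ
  have ht0 : 0 < t := Real.sqrt_pos.2 hωpos
  have ht2 : t ^ 2 = ω ρ := Real.sq_sqrt hωpos.le
  set m := Real.sqrt (2 * K) * Real.sqrt (ν Φ) * (4 * (2 + M)) with hm
  have hm0 : 0 ≤ m := by positivity
  have hK0 : 0 ≤ K := (norm_nonneg (D2 (f x₀) A)).trans (hK A (by linarith))
  set C := (D * 2 ^ Q + D * (1 + M) ^ Q + K * (1 + M)) *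
        (4 * ((1 + M) * 2 ^ Q) * (3 + 2 * M) ^ 2) with hC
  have hC0 : 0 ≤ C := by positivity
  have hD0 : 0 ≤ D := by positivity
  have hκ : 0 ≤ κ₀ * t ^ 2 := by positivity
  have hDuU : IntegrableOn Du U :=
    (hu.sobolev.2.1.integrableOn_compact_subset hball (isCompact_closedBall _ _)).mono_set
      Metric.ball_subset_closedBall
  obtain ⟨R, hR⟩ := exists_norm_grad_le hφ.1 hφ.2.1
  have i1 : IntegrableOn (fun x => fderiv ℝ (f x₀) A (grad φ x)) U :=
    ((fderiv ℝ (f x₀) A).integrable_comp (integrable_grad hφ.1 hφ.2.1)).integrableOn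
  have i2 : IntegrableOn (fun x => D2 (f x₀) A (Du x - A) (grad φ x)) U :=
    integrableOn_clm_apply_grad (hDuU.sub (integrableOn_const hUfin)) _ hφ.1 hR
  have i3 : IntegrableOn (fun x => ‖V q (Du x) - V q A‖ ^ 2) U :=
    integrableOn_V_sub_sq hUfin (by linarith) hDuU.aestronglyMeasurable hDq A
  obtain ⟨hdi, hde⟩ := setIntegral_error_terms hUfin i1 i2 i3 t (K * t ^ 2 + 2 * (κ₀ * t ^ 2)) m Φ
    (2 / Φ) C
  have hpos := hu.integral_nonneg (hs.energy_lt_top hL hΩ hb hint) hΩ.measurableSet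
    (fun x hx => hs.integrand_nonneg hL hx) measurableSet_ball hUΩ (hφ.const_smul t) hdi (by
      intro x hx
      rw [grad_const_smul]
      exact le_add_linearization (hs.smooth x₀ hx₀) hν hK
        ((hs.smooth x (hUΩ hx)).differentiable two_ne_zero) (D := D) hD0 hq hqQ
        (hs.norm_fderiv_le hL hΩ (hUΩ hx) (hpq x hx) hqQ)
        (hs.norm_fderiv_le hL hΩ hx₀ (hpq x₀ (Metric.mem_ball_self hρ)) hqQ)
        (κ := κ₀ * t ^ 2) hκ
        (fun B hB => by
          rw [ht2]
          exact hs.abs_sub_le hL (hUΩ hx) hx₀ ((hpq x hx).trans hqQ)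
            ((hpq x₀ (Metric.mem_ball_self hρ)).trans hqQ) hx hB)
        hΦ (ξ := Du x) hA (hφ1 x hx) ht0.le hω)
  -- The term with `Df(x₀, A)` vanishes because a compactly supported gradient has mean zero.
  rw [hde, integral_clm_grad _ hφ.1 hφ.2.1 hφ.2.2, mul_zero, zero_add] at hpos
  rw [setAverage_eq, smul_eq_mul] at hΦ2 ⊢
  have hv : 0 < volume.real U :=
    ENNReal.toReal_pos (Metric.measure_ball_pos volume x₀ hρ).ne' hUfin
  rw [inv_mul_le_iff₀ hv] at hΦ2
  refine (neg_inv_mul_le_of_error_terms hv ht0 hΦ hm0 hC0 hΦ2 hpos).trans_eq ?_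
  rw [hm, hκ₀]
  ring

/-- The estimate for test functions with `|Dφ| ≤ 1`. -/
theorem abs_setAverage_D2_le (hL : 1 ≤ L) (hΩ : IsOpen Ω) (hb : Bornology.IsBounded Ω)
    (hs : StructureConditions Ω f p ω μ L α) (hu : IsLocalMinimizer Ω f p u Du)
    (hint : IntegrableOn (fun x => ‖Du x‖ ^ p x) Ω) {x₀ : Vec n} {ρ : ℝ} (hρ : 0 < ρ)
    (hball : Metric.closedBall x₀ (2 * ρ) ⊆ Ω) {q Q : ℝ} (hq : 1 ≤ q) (hqQ : q ≤ Q)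
    (hpq : ∀ x ∈ Metric.ball x₀ ρ, p x ≤ q)
    (hDq : IntegrableOn (fun x => ‖Du x‖ ^ q) (Metric.ball x₀ (2 * ρ))) {M K Mbar : ℝ}
    (hMbar : ⨍ x in Metric.ball x₀ (2 * ρ), ‖Du x‖ ^ q ≤ Mbar)
    (hK : ∀ B : Hom n N, ‖B‖ ≤ M + 1 → ‖D2 (f x₀) B‖ ≤ K) {ν : ℝ → ℝ}
    (hν : IsD2Modulus (f x₀) M ν) {A : Hom n N} (hA : ‖A‖ ≤ M) {φ : Vec n → Vec N}
    (hφ : IsTestFun 1 (Metric.ball x₀ ρ) φ) (hφ1 : ∀ x ∈ Metric.ball x₀ ρ, ‖grad φ x‖ ≤ 1)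
    {Φ : ℝ} (hΦ0 : 0 ≤ Φ)
    (hΦ2 : ⨍ x in Metric.ball x₀ ρ, ‖V q (Du x) - V q A‖ ^ 2 ≤ Φ ^ 2) :
    |⨍ x in Metric.ball x₀ ρ, D2 (f x₀) A (Du x - A) (grad φ x)| ≤
      (K + 12 * L * ((1 + (M + 1) ^ 2) ^ (Q / 2) * (2 + (M + 1) ^ 2)) +
        2 * K * (1 + M + 2 ^ n * Mbar)) * Real.sqrt (ω ρ) +
      12 * (2 + M) * Real.sqrt (2 * K) * (Real.sqrt (ν Φ) * Φ) +
      (N * n * (L * 3 ^ Q) * 2 ^ Q + N * n * (L * 3 ^ Q) * (1 + M) ^ Q + K * (1 + M)) *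
        (4 * ((1 + M) * 2 ^ Q) * (3 + 2 * M) ^ 2) * Φ ^ 2 := by
  have hK0 : 0 ≤ K := (norm_nonneg (D2 (f x₀) A)).trans (hK A (by linarith))
  have hM : 0 ≤ M := (norm_nonneg A).trans hA
  have hL0 : 0 ≤ L := zero_le_one.trans hL
  have hball1 : Metric.closedBall x₀ ρ ⊆ Ω :=
    (Metric.closedBall_subset_closedBall (by linarith)).trans hball
  have hsub : Metric.ball x₀ ρ ⊆ Metric.ball x₀ (2 * ρ) := Metric.ball_subset_ball (by linarith)
  have hMbar0 : 0 ≤ Mbar := by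
    refine le_trans ?_ hMbar
    rw [setAverage_eq]
    exact smul_nonneg (by positivity) (integral_nonneg fun x => by positivity)
  have hUfin : volume (Metric.ball x₀ ρ) ≠ ⊤ := measure_ball_lt_top.ne
  have hDuU : IntegrableOn Du (Metric.ball x₀ ρ) :=
    (hu.sobolev.2.1.integrableOn_compact_subset hball1 (isCompact_closedBall _ _)).mono_set
      Metric.ball_subset_closedBall
  have hDq1 := hDq.mono_set hsub
  have hv : 0 < volume.real (Metric.ball x₀ ρ) :=
    ENNReal.toReal_pos (Metric.measure_ball_pos volume x₀ hρ).ne' hUfin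
  have hω0 : 0 ≤ Real.sqrt (ω ρ) := Real.sqrt_nonneg _
  -- The weight `1/Φ` excludes `Φ = 0`; in that case `Du = A` almost everywhere in the ball, by the
  -- two coercivity bounds.
  rcases hΦ0.eq_or_lt with rfl | hΦ
  · have hi := integrableOn_V_sub_sq hUfin (by linarith) hDuU.aestronglyMeasurable hDq1 A
    have hzero : ∫ x in Metric.ball x₀ ρ, ‖V q (Du x) - V q A‖ ^ 2 = 0 := by
      refine le_antisymm ?_ (integral_nonneg fun x => by positivity)
      rw [setAverage_eq, smul_eq_mul, inv_mul_le_iff₀ hv] at hΦ2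
      simpa using hΦ2
    have hae := (setIntegral_eq_zero_iff_of_nonneg_ae
      (Eventually.of_forall fun x => by positivity) hi).1 hzero
    have h0 : ∫ x in Metric.ball x₀ ρ, D2 (f x₀) A (Du x - A) (grad φ x) = 0 := by
      apply integral_eq_zero_of_ae
      filter_upwards [hae] with x hx
      simp only [Pi.zero_apply] at hx
      have hDA : Du x - A = 0 := by
        rcases le_total ‖Du x - A‖ (1 / 2) with hn | hf
        · have := norm_sub_sq_le_V_sub_sq hq hA hn
          rw [hx, mul_zero] at this
          exact norm_eq_zero.1 (pow_eq_zero_iff two_ne_zero |>.1 (this.antisymm (sq_nonneg _)))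
        · have := one_add_norm_rpow_le_V_sub_sq hq hqQ hA hf
          rw [hx, mul_zero] at this
          exact absurd this (not_le.2 (by positivity))
      simp [hDA]
    rw [setAverage_eq, h0, smul_zero, abs_zero]
    positivity
  rcases le_total (Real.sqrt (ω ρ)) (1 / 2) with hω | hω
  · have hneg : IsTestFun 1 (Metric.ball x₀ ρ) fun x => (-1 : ℝ) • φ x := hφ.const_smul (-1)
    have h1 := neg_setAverage_D2_le hL hΩ hb hs hu hint hρ hball1 hq hqQ hpq hDq1 hK hν hA hφ hφ1
      hω hΦ hΦ2
    have h2 := neg_setAverage_D2_le hL hΩ hb hs hu hint hρ hball1 hq hqQ hpq hDq1 hK hν hA hneg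
      (fun x hx => by rw [grad_const_smul, neg_one_smul, norm_neg]; exact hφ1 x hx) hω hΦ hΦ2
    have e : ⨍ x in Metric.ball x₀ ρ, D2 (f x₀) A (Du x - A) (grad (fun x => (-1 : ℝ) • φ x) x) =
        -⨍ x in Metric.ball x₀ ρ, D2 (f x₀) A (Du x - A) (grad φ x) := by
      simp only [grad_const_smul, map_smul, smul_eq_mul, neg_mul, one_mul]
      rw [setAverage_eq, setAverage_eq, integral_neg, smul_neg]
    rw [e, neg_neg] at h2
    have h3 : 0 ≤ 2 * K * (1 + M + 2 ^ n * Mbar) * Real.sqrt (ω ρ) := by positivity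
    rw [abs_le]
    constructor <;> nlinarith
  -- For large `ω(ρ)` the average is bounded by `K(1 + M + 2^n Mbar)`, where `2^n` is the ratio of
  -- the ball volumes; the factor `2√ω(ρ) ≥ 1` absorbs it.
  · have hD1 : ∫ x in Metric.ball x₀ ρ, ‖Du x‖ ^ q ≤
        volume.real (Metric.ball x₀ ρ) * (2 ^ n * Mbar) := by
      have h1 : ∫ x in Metric.ball x₀ ρ, ‖Du x‖ ^ q ≤ ∫ x in Metric.ball x₀ (2 * ρ), ‖Du x‖ ^ q :=
        setIntegral_mono_set hDq (Eventually.of_forall fun x => by positivity) hsub.eventuallyLE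
      have hv2 : 0 < volume.real (Metric.ball x₀ (2 * ρ)) := by
        rw [volume_real_ball_two_mul]
        positivity
      rw [setAverage_eq, smul_eq_mul, inv_mul_le_iff₀ hv2, volume_real_ball_two_mul] at hMbar
      linarith
    have hg : IntegrableOn (fun x => K * (1 + M + ‖Du x‖ ^ q)) (Metric.ball x₀ ρ) :=
      ((integrableOn_const hUfin).add hDq1).const_mul K
    have hbound : |∫ x in Metric.ball x₀ ρ, D2 (f x₀) A (Du x - A) (grad φ x)| ≤
        ∫ x in Metric.ball x₀ ρ, K * (1 + M + ‖Du x‖ ^ q) := by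
      rw [← Real.norm_eq_abs]
      apply norm_integral_le_of_norm_le hg
      filter_upwards [ae_restrict_mem measurableSet_ball] with x hx
      have a1 := (D2 (f x₀) A).le_opNorm₂ (Du x - A) (grad φ x)
      have a2 : ‖Du x‖ ≤ 1 + ‖Du x‖ ^ q := by
        rcases le_total ‖Du x‖ 1 with h | h
        · have : 0 ≤ ‖Du x‖ ^ q := by positivity
          linarith
        · have := Real.rpow_le_rpow_of_exponent_le h hq
          rw [Real.rpow_one] at this
          linarith
      have a3 := norm_sub_le (Du x) A
      calc _ ≤ ‖D2 (f x₀) A‖ * ‖Du x - A‖ * ‖grad φ x‖ := a1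
        _ ≤ K * (1 + M + ‖Du x‖ ^ q) * 1 := by
          gcongr
          · exact hK A (by linarith)
          · linarith
          · exact hφ1 x hx
        _ = _ := mul_one _
    have e : ∫ x in Metric.ball x₀ ρ, K * (1 + M + ‖Du x‖ ^ q) =
        K * (volume.real (Metric.ball x₀ ρ) * (1 + M) + ∫ x in Metric.ball x₀ ρ, ‖Du x‖ ^ q) := by
      have ic : IntegrableOn (fun _ => 1 + M) (Metric.ball x₀ ρ) := integrableOn_const hUfin
      rw [integral_const_mul, integral_add ic hDq1, setIntegral_const, smul_eq_mul]
    rw [setAverage_eq, smul_eq_mul, abs_mul, abs_of_nonneg (inv_nonneg.2 hv.le)]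
    have h1 : (volume.real (Metric.ball x₀ ρ))⁻¹ *
        |∫ x in Metric.ball x₀ ρ, D2 (f x₀) A (Du x - A) (grad φ x)| ≤
        K * (1 + M + 2 ^ n * Mbar) := by
      rw [inv_mul_le_iff₀ hv]
      refine (hbound.trans_eq e).trans ?_
      have := mul_le_mul_of_nonneg_left hD1 hK0
      linarith
    have h2 : K * (1 + M + 2 ^ n * Mbar) ≤ 2 * K * (1 + M + 2 ^ n * Mbar) * Real.sqrt (ω ρ) := by
      have : 0 ≤ K * (1 + M + 2 ^ n * Mbar) := by positivity
      nlinarith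
    have h3 : 0 ≤ (K + 12 * L * ((1 + (M + 1) ^ 2) ^ (Q / 2) * (2 + (M + 1) ^ 2))) *
      Real.sqrt (ω ρ) := by positivity
    have h4 : 0 ≤ 12 * (2 + M) * Real.sqrt (2 * K) * (Real.sqrt (ν Φ) * Φ) := by positivity
    have h5 : 0 ≤ (N * n * (L * 3 ^ Q) * 2 ^ Q + N * n * (L * 3 ^ Q) * (1 + M) ^ Q + K * (1 + M)) *
        (4 * ((1 + M) * 2 ^ Q) * (3 + 2 * M) ^ 2) * Φ ^ 2 := by positivity
    rw [add_mul]
    linarith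

end Main

theorem bddAbove_range_norm_grad {n N : ℕ} {U : Set (Vec n)} {φ : Vec n → Vec N}
    (hφ : IsTestFun 1 U φ) : BddAbove (range fun x : U => ‖grad φ x‖) := by
  obtain ⟨R, hR⟩ := exists_norm_grad_le hφ.1 hφ.2.1
  exact ⟨R, by rintro _ ⟨x, rfl⟩; exact hR x⟩

theorem mainTheorem4 :
    ∃ ρ₀ : ℝ → ℝ, (∀ α : ℝ, 0 < α → α ≤ 1 → 0 < ρ₀ α) ∧
    ∀ (n N : ℕ) (q₁ q₂ L Mbar Mhat K : ℝ), 1 ≤ n → 1 ≤ N → 1 < q₁ → q₁ ≤ q₂ → 1 ≤ L →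
      0 < Mbar → 0 < Mhat →
    ∃ c : ℝ, 0 < c ∧
    ∀ (α μ : ℝ) (Ω : Set (Vec n)) (f : Vec n → Hom n N → ℝ) (p : Vec n → ℝ) (ω : ℝ → ℝ)
      (u : Vec n → Vec N) (Du : Vec n → Hom n N),
      0 < α → α ≤ 1 →
      IsOpen Ω → IsConnected Ω → Bornology.IsBounded Ω →
      StructureConditions Ω f p ω μ L α →
      IsLocalMinimizer Ω f p u Du →
      IntegrableOn (fun x => ‖Du x‖ ^ p x) Ω →
    ∀ (x₀ : Vec n) (ρ : ℝ), 0 < ρ → ρ ≤ ρ₀ α → Metric.closedBall x₀ (2 * ρ) ⊆ Ω →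
      q₁ ≤ pTwo p x₀ ρ → pTwo p x₀ ρ ≤ q₂ →
      IntegrableOn (fun x => ‖Du x‖ ^ pTwo p x₀ ρ) (Metric.ball x₀ (2 * ρ)) →
      ⨍ x in Metric.ball x₀ (2 * ρ), ‖Du x‖ ^ pTwo p x₀ ρ ≤ Mbar →
      (∀ B : Hom n N, ‖B‖ ≤ Mhat + 1 → ‖D2 (f x₀) B‖ ≤ K) →
    ∀ ν : ℝ → ℝ, IsD2Modulus (f x₀) Mhat ν →
    ∀ A : Hom n N, ‖A‖ ≤ Mhat →
    ∀ φ : Vec n → Vec N, IsTestFun 1 (Metric.ball x₀ ρ) φ →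
      |⨍ x in Metric.ball x₀ ρ, D2 (f x₀) A (Du x - A) (grad φ x)| ≤
        c * (excess p Du x₀ ρ A ^ 2
            + Real.sqrt (ν (excess p Du x₀ ρ A)) * excess p Du x₀ ρ A
            + Real.sqrt (ω ρ)) *
          ⨆ x : Metric.ball x₀ ρ, ‖grad φ x‖ := by
  -- Large values of `ω ρ` are covered by the crude bound, so no smallness of the radius has to be
  -- arranged.
  refine ⟨fun _ => 1, fun _ _ _ => one_pos, ?_⟩
  intro n N q₁ q₂ L Mbar Mhat K _ _ hq₁ hq₁₂ hL hMbar hMhat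
  -- The coefficients of `√ω(ρ)`, `√ν(Φ) Φ` and `Φ²`. They are fixed before `0 ≤ K` is known, hence
  -- `|K|`.
  set a : ℝ := |K| + 12 * L * ((1 + (Mhat + 1) ^ 2) ^ (q₂ / 2) * (2 + (Mhat + 1) ^ 2)) +
    2 * |K| * (1 + Mhat + 2 ^ n * Mbar) with ha
  set b : ℝ := 12 * (2 + Mhat) * Real.sqrt (2 * |K|) with hb
  set d : ℝ := (N * n * (L * 3 ^ q₂) * 2 ^ q₂ + N * n * (L * 3 ^ q₂) * (1 + Mhat) ^ q₂ +
    |K| * (1 + Mhat)) * (4 * ((1 + Mhat) * 2 ^ q₂) * (3 + 2 * Mhat) ^ 2) with hd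
  have hL0 : 0 ≤ L := zero_le_one.trans hL
  have ha0 : 0 ≤ a := by positivity
  have hb0 : 0 ≤ b := by positivity
  have hd0 : 0 ≤ d := by positivity
  refine ⟨a + b + d + 1, by positivity, ?_⟩
  intro α μ Ω f p ω u Du _ _ hΩ _ hbd hs hu hint x₀ ρ hρ _ hball hq₁p hpq₂ hDq hM hK ν hν A hA φ hφ
  set q := pTwo p x₀ ρ with hq
  set Φ := excess p Du x₀ ρ A with hΦ
  have hΦ0 : 0 ≤ Φ := Real.sqrt_nonneg _
  have hsub : Metric.ball x₀ (2 * ρ) ⊆ Ω := Metric.ball_subset_closedBall.trans hball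
  have hpq : ∀ x ∈ Metric.ball x₀ ρ, p x ≤ q := by
    obtain ⟨γ₁, γ₂, -, h2⟩ := hs.p_bounds
    intro x hx
    refine le_csSup ⟨γ₂, ?_⟩ ⟨x, Metric.ball_subset_ball (by linarith) hx, rfl⟩
    rintro _ ⟨y, hy, rfl⟩
    exact (h2 y (hsub hy)).2
  have hΦ2 : ⨍ x in Metric.ball x₀ ρ, ‖V q (Du x) - V q A‖ ^ 2 ≤ Φ ^ 2 := by
    rw [hΦ, excess, Real.sq_sqrt]
    rw [setAverage_eq]
    exact smul_nonneg (by positivity) (integral_nonneg fun x => by positivity)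
  set S := ⨆ x : Metric.ball x₀ ρ, ‖grad φ x‖ with hS
  have hgS : ∀ x ∈ Metric.ball x₀ ρ, ‖grad φ x‖ ≤ S := fun x hx =>
    le_ciSup (bddAbove_range_norm_grad hφ) (⟨x, hx⟩ : Metric.ball x₀ ρ)
  have hS0 : 0 ≤ S := (norm_nonneg _).trans (hgS x₀ (Metric.mem_ball_self hρ))
  rcases hS0.eq_or_lt with h0 | hSpos
  · have hz : ∫ x in Metric.ball x₀ ρ, D2 (f x₀) A (Du x - A) (grad φ x) = 0 := by
      apply setIntegral_eq_zero_of_forall_eq_zero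
      intro x hx
      rw [norm_le_zero_iff.1 ((hgS x hx).trans_eq h0.symm), map_zero]
    rw [setAverage_eq, hz, smul_zero, abs_zero, ← h0, mul_zero]
  -- The average is linear in `φ`, so the estimate for `S⁻¹ φ`, whose gradient has norm at most `1`,
  -- rescales to `φ`.
  have hψ := hφ.const_smul S⁻¹
  have key := abs_setAverage_D2_le hL hΩ hbd hs hu hint hρ hball (by linarith) hpq₂ hpq hDq hM
    (fun B hB => (hK B hB).trans (le_abs_self K)) hν hA hψ
    (fun x hx => by
      rw [grad_const_smul, norm_smul, norm_inv, Real.norm_of_nonneg hS0, inv_mul_le_iff₀ hSpos,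
        mul_one]
      exact hgS x hx) hΦ0 hΦ2
  have e : ⨍ x in Metric.ball x₀ ρ, D2 (f x₀) A (Du x - A) (grad (fun x => S⁻¹ • φ x) x) =
      S⁻¹ * ⨍ x in Metric.ball x₀ ρ, D2 (f x₀) A (Du x - A) (grad φ x) := by
    simp only [grad_const_smul, map_smul, smul_eq_mul]
    rw [setAverage_eq, setAverage_eq, integral_const_mul, smul_eq_mul, smul_eq_mul]
    ring
  rw [e, abs_mul, abs_inv, abs_of_pos hSpos, inv_mul_le_iff₀ hSpos, mul_comm S] at key
  refine key.trans (mul_le_mul_of_nonneg_right ?_ hS0)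
  rw [← ha, ← hb, ← hd]
  have h1 : 0 ≤ Real.sqrt (ω ρ) := Real.sqrt_nonneg _
  have h2 : 0 ≤ Real.sqrt (ν Φ) * Φ := by positivity
  have h3 : 0 ≤ Φ ^ 2 := by positivity
  calc a * Real.sqrt (ω ρ) + b * (Real.sqrt (ν Φ) * Φ) + d * Φ ^ 2 ≤
      (a + b + d + 1) * Real.sqrt (ω ρ) + (a + b + d + 1) * (Real.sqrt (ν Φ) * Φ) +
        (a + b + d + 1) * Φ ^ 2 := by
        gcongr <;> linarith
    _ = _ := by ring
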